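/- **Setting.** Let $\mathcal T$ be a triangulated category with countable coproducts and suspension $\Sigma$ (for example the homotopy category $Ho(\mathcal C)$ of a stable model category), and write $[-,-]$ for its morphism groups. For a simplicial object $C_\bullet$ of $\mathcal T$ let $d^C_n : C_{n+1}\to C_n$ be the alternating sum of the face maps, and put $C_s=0$ for $s<0$. A *totalization* of $C_\bullet$ consists of a tower of skeleta $0=T_{-1}\to T_0\to T_1\to\cdots$ and distinguished triangles $$\Sigma^{s}C_{s+1}\xrightarrow{\;a_s\;}T_s\to T_{s+1}\xrightarrow{\;\pi_{s+1}\;}\Sigma^{s+1}C_{s+1}$$ such that the composite $\pi_s a_s$ is $\Sigma^s d^C_s$, together with a homotopy colimit $\mathrm{Tot}\,C_\bullet$ of the $T_s$. ($C_\bullet$ is *totalizable* if a totalization exists.) For $i\ge 0$ let $T_{[i,j]}$ be a cone of $T_{i-1}\to T_j$; these form a tower $T_{[i,i]}=\Sigma^iC_i\to T_{[i,i+1]}\to\cdots$ with triangles $\Sigma^sC_{s+1}\xrightarrow{a_s}T_{[i,s]}\to T_{[i,s+1]}\to\Sigma^{s+1}C_{s+1}$ compatible with those of the $T_s$. *Toda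 brackets.* Let $C_\bullet$, $D_\bullet$ be simplicial objects with chosen totalizations and let $f_\bullet:C_\bullet\to D_\bullet$ be a simplicial map. For $N\ge 2$ and $i\ge 0$, the bracket $T(N,i;f_\bullet)\subseteq[\Sigma^{N-1}C_{i+N},D_i]$ is the set of all $\tau$ arising as follows, for some choice of the towers $T^C_{[i,\cdot]}$, $T^D_{[i,\cdot]}$ of subquotients: there is a filtration-preserving map $\varphi:T^C_{[i,i+N-1]}\to T^D_{[i,i+N-1]}$ (that is, a family of maps $T^C_{[i,s]}\to T^D_{[i,s]}$, $i\le s\le i+N-1$, which together with the maps $\Sigma^sf_s$ on the subquotients $\Sigma^sC_s\to\Sigma^sD_s$ form maps of the triangles above), and the composite of $\Sigma^i\tau$ with $\Sigma^iD_i\to T^D_{[i,i+N-1]}$ is the difference $$\varphi\circ a^C_{i+N-1}-a^D_{i+N-1}\circ\Sigma^{i+N-1}f_{i+N}:\Sigma^{i+N-1}C_{i+N}\to T^D_{[i,i+N-1]}.$$ The bracket *vanishes* if it contains $0$. **Theorem.** Let $f_\bullet:C_\bullet\to D_\bullet$ be a map of simplicial objects of $\mathcal T$ with given totalizations, and let $S$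 be an object of $\mathcal T$. Let $H$ be either the cohomological functor $H(-)=[-,S]$ or the homological functor $H(-)=[S,-]$. 1. Applying $H$ to the skeletal tower of $C_\bullet$ gives an exact couple and hence a spectral sequence $$E_1^{s,t}\cong H(\Sigma^tC_s)\Longrightarrow H(\Sigma^{t-s}\mathrm{Tot}\,C_\bullet)$$ (zero for $s<0$), in which $d_r$ has bidegree $(r,r-1)$ for $H=[-,S]$ and $(-r,1-r)$ for $H=[S,-]$, and $d_1$ is induced by $\Sigma^td^C$; likewise for $D_\bullet$. Convergence is conditional, in the following sense. For $H=[-,S]$, the groups $H(\Sigma^nT_m)$ vanish for $m<0$ and there are exact sequences $0\to\lim^1_mH(\Sigma^{n+1}T_m)\to H(\Sigma^n\mathrm{Tot}\,C_\bullet)\to\lim_mH(\Sigma^nT_m)\to0$. For $H=[S,-]$, the limit and derived limit of $H(\Sigma^nT_m)$ for $m\to-\infty$ vanish, so that the spectral sequence converges conditionally to $\operatorname{colim}_mH(\Sigma^nT_m)$; and if $S$ is compact (every map from $S$ to a countable coproduct is a finite sum of maps to the summands) the canonical map from this colimit to $H(\Sigma^n\mathrm{Tot}\,C_\bullet)$ is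 an isomorphism. 2. The maps $H(\Sigma^tf_s)$ form a map between the $E_1$-pages of the two spectral sequences that commutes with $d_1$. 3. Let $k>2$ and suppose that the Toda brackets $T(N,i;f_\bullet)$ vanish for all $2\le N<k$ and all $i\ge0$. Then $f_\bullet$ induces maps between the $E_r$-pages of the two spectral sequences for all $1\le r<k$, and these commute with the differentials $d_r$: the map of $E_1$-pages is the one in 2., and for $r+1<k$ the map of $E_{r+1}$-pages is the one that the map of $E_r$-pages induces on homology. The maps in 2. and 3. go from the pages for $C_\bullet$ to those for $D_\bullet$ if $H=[S,-]$, and from the pages for $D_\bullet$ to those for $C_\bullet$ if $H=[-,S]$. -/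

import Mathlib

open CategoryTheory Category Limits Pretriangulated

universe v u

/-- Bookkeeping for a bigraded exact couple.  A position `p = (s, t)` of the first page has a
filtration degree `fil p`; `jdeg p` and `kdeg p` are the total degrees in which the maps
`j : A → E` (into position `p`) and `k : E → A` (out of position `p`) live, and `shift r` is the
bidegree of the differential `d_r`. -/
structure CoupleGrading where
  fil : ℤ × ℤ → ℤ
  jdeg : ℤ × ℤ → ℤ
  kdeg : ℤ × ℤ → ℤ
  shift : ℤ → ℤ × ℤ
  fil_shift : ∀ p r, fil (p + shift r) = fil p + r
  jdeg_shift : ∀ p r, jdeg (p + shift r) = kdeg p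

/-- An (unrolled) exact couple of abelian groups: a decreasing system
`⋯ ⟶ A (σ + 1) ⟶ A σ ⟶ ⋯` and long exact sequences
`⋯ ⟶ A (σ + 1) ⟶ A σ ⟶ E ⟶ A (σ + 1) ⟶ A σ ⟶ ⋯`. -/
structure ExactCouple (g : CoupleGrading) where
  A : ℤ → ℤ → Type v
  E : ℤ × ℤ → Type v
  [instA : ∀ σ n, AddCommGroup (A σ n)]
  [instE : ∀ p, AddCommGroup (E p)]
  i : ∀ {σ σ' : ℤ} (_ : σ ≤ σ') (n : ℤ), A σ' n →+ A σ n
  j : ∀ p, A (g.fil p) (g.jdeg p) →+ E p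
  k : ∀ (p : ℤ × ℤ) {σ n : ℤ} (_ : g.fil p + 1 = σ) (_ : g.kdeg p = n), E p →+ A σ n
  i_refl : ∀ (σ n : ℤ) (a : A σ n), i (le_refl σ) n a = a
  i_trans : ∀ {σ σ' σ'' : ℤ} (h : σ ≤ σ') (h' : σ' ≤ σ'') (n : ℤ) (a : A σ'' n),
    i h n (i h' n a) = i (h.trans h') n a
  exact_E : ∀ (p : ℤ × ℤ) {σ n : ℤ} (hσ : g.fil p + 1 = σ) (hn : g.kdeg p = n),
    Function.Exact (j p) (k p hσ hn)
  exact_j : ∀ (p : ℤ × ℤ) {σ : ℤ} (hσ : g.fil p + 1 = σ),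
    Function.Exact (i (show g.fil p ≤ σ by omega) (g.jdeg p)) (j p)
  exact_k : ∀ (p : ℤ × ℤ) {σ n τ : ℤ} (hσ : g.fil p + 1 = σ) (hn : g.kdeg p = n)
    (hτ : τ = g.fil p), Function.Exact (k p hσ hn) (i (show τ ≤ σ by omega) n)

attribute [instance] ExactCouple.instA ExactCouple.instE

namespace ExactCouple

variable {g : CoupleGrading} (X : ExactCouple.{v} g)

/-- The group `Z_r` of `r`-cycles: the `x` such that `k x` lifts `r - 1` steps up the system. -/
def cycles (r : ℤ) (hr : 1 ≤ r) (p : ℤ × ℤ) : AddSubgroup (X.E p) where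
  carrier := {x | ∃ (σ n : ℤ) (hσ : g.fil p + r = σ) (hn : g.kdeg p = n) (a : X.A σ n),
    X.i (show g.fil p + 1 ≤ σ by omega) n a = X.k p rfl hn x}
  zero_mem' := ⟨_, _, rfl, rfl, 0, by simp⟩
  add_mem' := by
    rintro x y ⟨_, _, rfl, rfl, a, ha⟩ ⟨_, _, rfl, rfl, b, hb⟩
    exact ⟨_, _, rfl, rfl, a + b, by simp [ha, hb]⟩
  neg_mem' := by
    rintro x ⟨_, _, rfl, rfl, a, ha⟩
    exact ⟨_, _, rfl, rfl, -a, by simp [ha]⟩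

/-- The group `B_r` of `r`-boundaries: the `j a` such that `a` dies `r - 1` steps down. -/
def boundaries (r : ℤ) (hr : 1 ≤ r) (p : ℤ × ℤ) : AddSubgroup (X.E p) :=
  (X.i (show g.fil p - (r - 1) ≤ g.fil p by omega) (g.jdeg p)).ker.map (X.j p)

lemma j_mem_cycles (r : ℤ) (hr : 1 ≤ r) (p : ℤ × ℤ) (a : X.A (g.fil p) (g.jdeg p)) :
    X.j p a ∈ X.cycles r hr p :=
  ⟨_, _, rfl, rfl, 0, by simp [((X.exact_E p rfl rfl) _).2 ⟨a, rfl⟩]⟩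

/-- The entry `E_r = Z_r / B_r` of the `r`-th page. -/
abbrev Page (r : ℤ) (hr : 1 ≤ r) (p : ℤ × ℤ) : Type v :=
  X.cycles r hr p ⧸ (X.boundaries r hr p).addSubgroupOf (X.cycles r hr p)

/-- The class in `E_r` of an `r`-cycle. -/
def toPage (r : ℤ) (hr : 1 ≤ r) (p : ℤ × ℤ) : X.cycles r hr p →+ X.Page r hr p :=
  QuotientAddGroup.mk' _

lemma toPage_surjective (r : ℤ) (hr : 1 ≤ r) (p : ℤ × ℤ) :
    Function.Surjective (X.toPage r hr p) := QuotientAddGroup.mk'_surjective _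

lemma toPage_eq_zero_iff (r : ℤ) (hr : 1 ≤ r) (p : ℤ × ℤ) (x : X.cycles r hr p) :
    X.toPage r hr p x = 0 ↔ (x : X.E p) ∈ X.boundaries r hr p := by
  rw [toPage, QuotientAddGroup.mk'_apply, QuotientAddGroup.eq_zero_iff,
    AddSubgroup.mem_addSubgroupOf]

/-- `y` represents `d_r x`: there is a lift `a` of `k x` with `j a = y`. -/
def DiffRel (r : ℤ) (hr : 1 ≤ r) {p q : ℤ × ℤ} (h : p + g.shift r = q)
    (x : X.E p) (y : X.E q) : Prop :=
  ∃ a : X.A (g.fil q) (g.jdeg q),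
    X.i (show g.fil p + 1 ≤ g.fil q by rw [← h, g.fil_shift]; omega) _ a =
      X.k p rfl (by rw [← h, g.jdeg_shift]) x ∧ X.j q a = y

section

variable (r : ℤ) (hr : 1 ≤ r) {p q : ℤ × ℤ} (h : p + g.shift r = q)

lemma exists_diffRel_iff (x : X.E p) :
    (∃ y, X.DiffRel r hr h x y) ↔ x ∈ X.cycles r hr p := by
  constructor
  · rintro ⟨y, a, ha, -⟩
    exact ⟨_, _, by rw [← h, g.fil_shift], by rw [← h, g.jdeg_shift], a, ha⟩
  · rintro ⟨σ, n, hσ, hn, a, ha⟩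
    obtain rfl : g.fil q = σ := by rw [← h, g.fil_shift, hσ]
    obtain rfl : g.jdeg q = n := by rw [← h, g.jdeg_shift, hn]
    exact ⟨X.j q a, a, ha, rfl⟩

variable {r hr h}

lemma DiffRel.mem_cycles {x : X.E p} {y : X.E q} (H : X.DiffRel r hr h x y) (r' : ℤ)
    (hr' : 1 ≤ r') : y ∈ X.cycles r' hr' q := by
  obtain ⟨a, -, rfl⟩ := H
  exact X.j_mem_cycles r' hr' q a

lemma DiffRel.add {x x' : X.E p} {y y' : X.E q} (H : X.DiffRel r hr h x y)
    (H' : X.DiffRel r hr h x' y') : X.DiffRel r hr h (x + x') (y + y') := by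
  obtain ⟨a, ha, rfl⟩ := H
  obtain ⟨b, hb, rfl⟩ := H'
  exact ⟨a + b, by simp [ha, hb], by simp⟩

lemma DiffRel.sub {x x' : X.E p} {y y' : X.E q} (H : X.DiffRel r hr h x y)
    (H' : X.DiffRel r hr h x' y') : X.DiffRel r hr h (x - x') (y - y') := by
  obtain ⟨a, ha, rfl⟩ := H
  obtain ⟨b, hb, rfl⟩ := H'
  exact ⟨a - b, by simp [ha, hb], by simp⟩

variable (r hr h)

lemma diffRel_zero_iff (y : X.E q) :
    X.DiffRel r hr h 0 y ↔ y ∈ X.boundaries r hr q := by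
  have e : g.fil p + 1 = g.fil q - (r - 1) := by rw [← h, g.fil_shift]; omega
  simp only [DiffRel, boundaries, AddSubgroup.mem_map, AddMonoidHom.mem_ker, map_zero]
  constructor
  · rintro ⟨a, ha, rfl⟩
    refine ⟨a, ?_, rfl⟩
    rw [← X.i_trans (show g.fil q - (r - 1) ≤ g.fil p + 1 by omega) (by omega), ha, map_zero]
  · rintro ⟨a, ha, rfl⟩
    refine ⟨a, ?_, rfl⟩
    rw [← X.i_trans (show g.fil p + 1 ≤ g.fil q - (r - 1) by omega) (by omega), ha, map_zero]

lemma diffRel_boundary {x : X.E p} (hx : x ∈ X.boundaries r hr p) : X.DiffRel r hr h x 0 := by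
  obtain ⟨a, -, rfl⟩ := hx
  have e : g.kdeg p = g.jdeg q := by rw [← h, g.jdeg_shift]
  exact ⟨0, by simp [((X.exact_E p rfl e) _).2 ⟨a, rfl⟩], by simp⟩

/-- `d_r` vanishes on an `r`-cycle exactly if it is an `(r + 1)`-cycle. -/
lemma diffRel_boundary_iff {x : X.E p} {y : X.E q} (H : X.DiffRel r hr h x y) :
    y ∈ X.boundaries r hr q ↔ x ∈ X.cycles (r + 1) (by omega) p := by
  have e : g.fil q = g.fil p + r := by rw [← h, g.fil_shift]
  have e' : g.kdeg p = g.jdeg q := by rw [← h, g.jdeg_shift]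
  obtain ⟨a, ha, rfl⟩ := H
  constructor
  · rintro ⟨b, hb, hab⟩
    obtain ⟨c, hc⟩ := ((X.exact_j q rfl) (a - b)).1 (by simp [hab])
    refine ⟨_, _, by omega, e', c, ?_⟩
    have hb' : X.i (show g.fil p + 1 ≤ g.fil q by omega) _ b = 0 := by
      rw [← X.i_trans (show g.fil p + 1 ≤ g.fil q - (r - 1) by omega) (by omega),
        AddMonoidHom.mem_ker.1 hb, map_zero]
    rw [← X.i_trans (show g.fil p + 1 ≤ g.fil q by omega) (by omega), hc, map_sub, hb', sub_zero,
      ha]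
  · rintro ⟨σ, n, hσ, hn, c, hc⟩
    obtain rfl : n = g.jdeg q := by omega
    refine ⟨a - X.i (by omega) _ c, ?_, ?_⟩
    · rw [SetLike.mem_coe, AddMonoidHom.mem_ker, ← X.i_trans (show g.fil q - (r - 1) ≤ g.fil p + 1 by omega)
        (by omega), map_sub, ha, X.i_trans, hc, sub_self, map_zero]
    · rw [map_sub, ((X.exact_j q (show g.fil q + 1 = σ by omega)) _).2 ⟨c, rfl⟩, sub_zero]

/-- The elements hit by `d_r` are the `(r + 1)`-boundaries. -/
lemma exists_diffRel_iff_mem_boundaries (y : X.E q) :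
    (∃ x : X.E p, X.DiffRel r hr h x y) ↔ y ∈ X.boundaries (r + 1) (by omega) q := by
  have e : g.fil q = g.fil p + r := by rw [← h, g.fil_shift]
  have e' : g.kdeg p = g.jdeg q := by rw [← h, g.jdeg_shift]
  constructor
  · rintro ⟨x, a, ha, rfl⟩
    refine ⟨a, ?_, rfl⟩
    rw [SetLike.mem_coe, AddMonoidHom.mem_ker, ← X.i_trans (show g.fil q - (r + 1 - 1) ≤ g.fil p + 1 by omega)
      (by omega), ha]
    exact ((X.exact_k p rfl e' (by omega)) _).2 ⟨x, rfl⟩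
  · rintro ⟨a, ha, rfl⟩
    obtain ⟨x, hx⟩ := ((X.exact_k p rfl e' (show g.fil q - (r + 1 - 1) = g.fil p by omega))
      (X.i (by omega) _ a)).1 (by rw [X.i_trans]; exact ha)
    exact ⟨x, a, hx.symm, rfl⟩

/-- A value of `d_r` on an `r`-cycle. -/
noncomputable def diffRep (x : X.cycles r hr p) : X.E q :=
  ((X.exists_diffRel_iff r hr h x.1).2 x.2).choose

lemma diffRep_spec (x : X.cycles r hr p) : X.DiffRel r hr h x.1 (X.diffRep r hr h x) :=
  ((X.exists_diffRel_iff r hr h x.1).2 x.2).choose_spec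

lemma toPage_eq_of_diffRel {x x' : X.E p} {y y' : X.cycles r hr q}
    (H : X.DiffRel r hr h x y.1) (H' : X.DiffRel r hr h x' y'.1)
    (hx : x - x' ∈ X.boundaries r hr p) : X.toPage r hr q y = X.toPage r hr q y' := by
  rw [← sub_eq_zero, ← map_sub, toPage_eq_zero_iff, ← X.diffRel_zero_iff r hr h]
  have := DiffRel.sub X (DiffRel.sub X H H') (X.diffRel_boundary r hr h hx)
  simpa using this

/-- The differential `d_r : E_r → E_r`, sending the class of `x` to the class of `j a`, where
`a` is any lift of `k x`. -/
noncomputable def diff : X.Page r hr p →+ X.Page r hr q :=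
  QuotientAddGroup.lift _
    (AddMonoidHom.mk' (fun x ↦ X.toPage r hr q
      ⟨X.diffRep r hr h x, DiffRel.mem_cycles X (X.diffRep_spec r hr h x) r hr⟩) (by
        intro x x'
        rw [← map_add]
        exact X.toPage_eq_of_diffRel r hr h (X.diffRep_spec r hr h (x + x'))
          (DiffRel.add X (X.diffRep_spec r hr h x) (X.diffRep_spec r hr h x'))
          (by simp)))
    (by
      intro x hx
      rw [AddSubgroup.mem_addSubgroupOf] at hx
      rw [AddMonoidHom.mem_ker, AddMonoidHom.mk'_apply, ← map_zero (X.toPage r hr q)]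
      exact X.toPage_eq_of_diffRel r hr h (X.diffRep_spec r hr h x)
        (X.diffRel_boundary r hr h (x := x.1) hx) (by simp))

lemma diff_toPage (x : X.cycles r hr p) (y : X.cycles r hr q) (H : X.DiffRel r hr h x.1 y.1) :
    X.diff r hr h (X.toPage r hr p x) = X.toPage r hr q y :=
  X.toPage_eq_of_diffRel r hr h (X.diffRep_spec r hr h x) H (by simp)

lemma exists_rep (x : X.cycles r hr p) : ∃ y : X.cycles r hr q, X.DiffRel r hr h x.1 y.1 :=
  ⟨⟨_, DiffRel.mem_cycles X (X.diffRep_spec r hr h x) r hr⟩, X.diffRep_spec r hr h x⟩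

lemma diff_toPage_eq_zero_iff (x : X.cycles r hr p) :
    X.diff r hr h (X.toPage r hr p x) = 0 ↔ x.1 ∈ X.cycles (r + 1) (by omega) p := by
  obtain ⟨y, H⟩ := X.exists_rep r hr h x
  rw [X.diff_toPage r hr h x y H, toPage_eq_zero_iff, X.diffRel_boundary_iff r hr h H]

lemma toPage_mem_range_diff_iff (y : X.cycles r hr q) :
    (∃ x, X.diff r hr h x = X.toPage r hr q y) ↔
      y.1 ∈ X.boundaries (r + 1) (by omega) q := by
  rw [← X.exists_diffRel_iff_mem_boundaries r hr h]
  constructor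
  · rintro ⟨x, hx⟩
    obtain ⟨x, rfl⟩ := X.toPage_surjective r hr p x
    obtain ⟨y', H⟩ := X.exists_rep r hr h x
    rw [X.diff_toPage r hr h x y' H, ← sub_eq_zero, ← map_sub, toPage_eq_zero_iff,
      ← X.diffRel_zero_iff r hr h] at hx
    exact ⟨x.1, by simpa using DiffRel.sub X H hx⟩
  · rintro ⟨x, H⟩
    exact ⟨X.toPage r hr p ⟨x, (X.exists_diffRel_iff r hr h x).1 ⟨_, H⟩⟩,
      X.diff_toPage r hr h _ _ H⟩

lemma cycles_le : X.cycles (r + 1) (by omega) p ≤ X.cycles r hr p := by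
  intro x hx
  obtain ⟨y, H⟩ : ∃ y, X.DiffRel r hr (rfl : p + g.shift r = _) x y := by
    rw [exists_diffRel_iff]
    obtain ⟨_, _, rfl, rfl, a, ha⟩ := hx
    exact ⟨_, _, rfl, rfl, X.i (by omega) _ a, by rw [X.i_trans, ha]⟩
  exact (X.exists_diffRel_iff r hr _ x).1 ⟨y, H⟩

lemma boundaries_le_cycles (r' : ℤ) (hr' : 1 ≤ r') :
    X.boundaries r hr p ≤ X.cycles r' hr' p := by
  rintro _ ⟨a, -, rfl⟩
  exact X.j_mem_cycles r' hr' p a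

end

/-- The `r`-th page of the spectral sequence of an exact couple. -/
noncomputable def page (r : ℤ) (hr : 1 ≤ r) :
    HomologicalComplex AddCommGrpCat.{v} (ComplexShape.up' (g.shift r)) where
  X p := AddCommGrpCat.of (X.Page r hr p)
  d p q := if h : p + g.shift r = q then AddCommGrpCat.ofHom (X.diff r hr h) else 0
  shape p q h := dif_neg h
  d_comp_d' p q q' h h' := by
    rw [dif_pos (show p + g.shift r = q from h), dif_pos (show q + g.shift r = q' from h')]
    refine AddCommGrpCat.hom_ext (AddMonoidHom.ext fun x ↦ ?_)
    obtain ⟨x, rfl⟩ := X.toPage_surjective r hr p x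
    obtain ⟨y, H⟩ := X.exists_rep r hr h x
    change X.diff r hr h' (X.diff r hr h (X.toPage r hr p x)) = 0
    rw [X.diff_toPage r hr h x y H]
    exact (X.diff_toPage_eq_zero_iff r hr h' y).2 (DiffRel.mem_cycles X H _ _)

lemma page_d_apply (r : ℤ) (hr : 1 ≤ r) {p q : ℤ × ℤ} (h : p + g.shift r = q)
    (x : X.Page r hr p) : ((X.page r hr).d p q).hom x = X.diff r hr h x := by
  simp only [page, dif_pos h]
  rfl

section

variable (r r' : ℤ) (hr : 1 ≤ r) (hrr' : r + 1 = r') (p : ℤ × ℤ)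

/-- The map from `(r + 1)`-cycles to the homology of the `r`-th page. -/
noncomputable def cyclesToHomology :
    X.cycles r' (by omega) p →+
      (((X.page r hr).sc p).g.hom.ker ⧸ ((X.page r hr).sc p).abToCycles.range) :=
  (QuotientAddGroup.mk' _).comp
    (((X.toPage r hr p).comp (AddSubgroup.inclusion (by subst hrr'; exact X.cycles_le r hr))).codRestrict
      ((X.page r hr).sc p).g.hom.ker (by
        intro x
        have hn : p + g.shift r = (ComplexShape.up' (g.shift r)).next p :=
          ((ComplexShape.up' (g.shift r)).next_eq' rfl).symm
        refine (X.page_d_apply r hr hn _).trans ?_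
        subst hrr'
        exact (X.diff_toPage_eq_zero_iff r hr hn _).2 x.2))

lemma cyclesToHomology_surjective :
    Function.Surjective (X.cyclesToHomology r r' hr hrr' p) := by
  subst hrr'
  intro y
  obtain ⟨⟨y, hy⟩, rfl⟩ := QuotientAddGroup.mk'_surjective _ y
  obtain ⟨x, rfl⟩ := X.toPage_surjective r hr p y
  have hn : p + g.shift r = (ComplexShape.up' (g.shift r)).next p :=
    ((ComplexShape.up' (g.shift r)).next_eq' rfl).symm
  have hx := (X.diff_toPage_eq_zero_iff r hr hn x).1
    ((X.page_d_apply r hr hn _).symm.trans hy)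
  exact ⟨⟨x.1, hx⟩, rfl⟩

lemma cyclesToHomology_ker :
    (X.cyclesToHomology r r' hr hrr' p).ker =
      (X.boundaries r' (by omega) p).addSubgroupOf (X.cycles r' (by omega) p) := by
  subst hrr'
  ext x
  have hp : (p - g.shift r) + g.shift r = p := sub_add_cancel _ _
  have hp' : (ComplexShape.up' (g.shift r)).prev p = p - g.shift r :=
    (ComplexShape.up' (g.shift r)).prev_eq' hp
  have hprev : (ComplexShape.up' (g.shift r)).prev p + g.shift r = p := by rw [hp', hp]
  rw [AddMonoidHom.mem_ker, AddSubgroup.mem_addSubgroupOf]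
  have := X.toPage_mem_range_diff_iff r hr hprev ⟨x.1, X.cycles_le r hr x.2⟩
  refine Iff.trans ?_ this
  refine (QuotientAddGroup.eq_zero_iff _).trans ?_
  constructor
  · rintro ⟨z, hz⟩
    exact ⟨z, (X.page_d_apply r hr hprev z).symm.trans (congrArg Subtype.val hz)⟩
  · rintro ⟨z, hz⟩
    exact ⟨z, Subtype.ext ((X.page_d_apply r hr hprev z).trans hz)⟩

/-- The homology of `E_r` is `E_{r+1}`; on representatives this is the identity. -/
noncomputable def pageEquiv :
    X.Page r' (by omega) p ≃+
      (((X.page r hr).sc p).g.hom.ker ⧸ ((X.page r hr).sc p).abToCycles.range) :=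
  (QuotientAddGroup.quotientAddEquivOfEq (X.cyclesToHomology_ker r r' hr hrr' p).symm).trans
    (QuotientAddGroup.quotientKerEquivOfSurjective _
      (X.cyclesToHomology_surjective r r' hr hrr' p))

end

/-- The spectral sequence of an exact couple. -/
noncomputable def spectralSequence :
    SpectralSequence AddCommGrpCat.{v} (fun r ↦ ComplexShape.up' (g.shift r)) 1 where
  page r hr := X.page r hr
  iso r r' p hrr' hr := ((X.page r hr).sc p).abHomologyIso ≪≫
    (X.pageEquiv r r' hr hrr' p).symm.toAddCommGrpIso

lemma cycles_one (p : ℤ × ℤ) : X.cycles 1 le_rfl p = ⊤ := by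
  rw [eq_top_iff]
  intro x _
  exact ⟨_, _, rfl, rfl, X.k p rfl rfl x, X.i_refl _ _ _⟩

lemma boundaries_one (p : ℤ × ℤ) : X.boundaries 1 le_rfl p = ⊥ := by
  rw [eq_bot_iff]
  rintro _ ⟨a, ha, rfl⟩
  have : a = 0 := by
    rw [← X.i_refl _ _ a, ← X.i_trans (show g.fil p ≤ g.fil p - (1 - 1) by omega) (by omega),
      AddMonoidHom.mem_ker.1 ha, map_zero]
  simp [this]

/-- The first page consists of the groups `E p`. -/
noncomputable def pageOneEquiv (p : ℤ × ℤ) : X.E p ≃+ X.Page 1 le_rfl p :=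
  AddEquiv.ofBijective
    ((X.toPage 1 le_rfl p).comp
      ((AddMonoidHom.id (X.E p)).codRestrict (X.cycles 1 le_rfl p)
        (fun x ↦ by simp [X.cycles_one p])))
    ⟨by
      rw [injective_iff_map_eq_zero]
      intro x hx
      have := (X.toPage_eq_zero_iff 1 le_rfl p _).1 hx
      rw [X.boundaries_one p] at this
      exact this,
    by
      intro y
      obtain ⟨x, rfl⟩ := X.toPage_surjective 1 le_rfl p y
      exact ⟨x.1, rfl⟩⟩

/-- The first page consists of the groups `E p`, as an isomorphism. -/
noncomputable def pageOneIso (p : ℤ × ℤ) :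
    AddCommGrpCat.of (X.E p) ≅ (X.spectralSequence.page 1).X p :=
  AddEquiv.toAddCommGrpIso (X := AddCommGrpCat.of (X.E p))
    (Y := AddCommGrpCat.of (X.Page 1 le_rfl p)) (X.pageOneEquiv p)

/-- The difference map `(a_m) ↦ (a_m - i a_{m+1})` of the system `A`, whose kernel is the limit
of the system and whose cokernel is its first derived limit. -/
def limDiff (n : ℤ) : (∀ m : ℕ, X.A m n) →+ (∀ m : ℕ, X.A m n) where
  toFun a m := a m - X.i (show (m : ℤ) ≤ ((m + 1 : ℕ) : ℤ) by omega) n (a (m + 1))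
  map_zero' := by ext; simp
  map_add' a b := by ext; simp [add_sub_add_comm]

/-- The derived limit `lim¹` of the system `⋯ ⟶ A 2 ⟶ A 1 ⟶ A 0` in total degree `n`. -/
abbrev LimOne (n : ℤ) : Type v := (∀ m : ℕ, X.A m n) ⧸ (X.limDiff n).range

/-- Conditional convergence to the limit, with abutment `G`: the system `A` has zero colimit, and
`G n` is related to it by the exact sequence `0 ⟶ lim¹ A (n + 1) ⟶ G n ⟶ lim A n ⟶ 0`, whose
second map has the components `ρ`. -/
structure ConvergesConditionallyToLimit (G : ℤ → Type v) [∀ n, AddCommGroup (G n)]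
    (ρ : ∀ σ n, G n →+ X.A σ n) : Prop where
  colim_eq_zero : ∀ (σ n : ℤ) (a : X.A σ n), ∃ (σ' : ℤ) (h : σ' ≤ σ), X.i h n a = 0
  compat : ∀ {σ σ' : ℤ} (h : σ ≤ σ') (n : ℤ) (x : G n), X.i h n (ρ σ' n x) = ρ σ n x
  lim_surjective : ∀ (n : ℤ) (a : ∀ m : ℕ, X.A m n), X.limDiff n a = 0 →
    ∃ x : G n, ∀ m : ℕ, ρ m n x = a m
  ker_eq_limOne : ∀ n : ℤ, ∃ l : X.LimOne (n + 1) →+ G n, Function.Injective l ∧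
    ∀ x : G n, x ∈ l.range ↔ ∀ m : ℕ, ρ m n x = 0

/-- Conditional convergence to the colimit: the limit and the derived limit of the system `A`
vanish. -/
structure ConvergesConditionallyToColimit : Prop where
  lim_eq_zero : ∀ n, Function.Injective (X.limDiff n)
  limOne_eq_zero : ∀ n, Function.Surjective (X.limDiff n)

/-- `G` is the colimit of the system `A` (along `σ → -∞`) via the maps `ρ`. -/
structure IsColimit (G : ℤ → Type v) [∀ n, AddCommGroup (G n)]
    (ρ : ∀ σ n, X.A σ n →+ G n) : Prop where
  compat : ∀ {σ σ' : ℤ} (h : σ ≤ σ') (n : ℤ) (a : X.A σ' n), ρ σ n (X.i h n a) = ρ σ' n a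
  surjective : ∀ (n : ℤ) (x : G n), ∃ (σ : ℤ) (a : X.A σ n), ρ σ n a = x
  injective : ∀ (σ n : ℤ) (a : X.A σ n), ρ σ n a = 0 → ∃ (σ' : ℤ) (h : σ' ≤ σ), X.i h n a = 0

end ExactCouple

section Triangulated

open scoped Simplicial

variable {𝒯 : Type u} [Category.{v} 𝒯] [Preadditive 𝒯]

section AltComplex

variable [HasZeroObject 𝒯]

open scoped ZeroObject

/-- The alternating sum complex `C_*` of a simplicial object, extended by zero to negative
degrees. -/
noncomputable def altComplex (C : SimplicialObject 𝒯) : ChainComplex 𝒯 ℤ where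
  X s := match s with
    | Int.ofNat n => C _⦋n⦌
    | Int.negSucc _ => 0
  d s s' := match s, s' with
    | Int.ofNat n, Int.ofNat m => (AlgebraicTopology.AlternatingFaceMapComplex.obj C).d n m
    | Int.ofNat _, Int.negSucc _ => 0
    | Int.negSucc _, _ => 0
  shape s s' h := by
    match s, s' with
    | Int.ofNat n, Int.ofNat m =>
      refine (AlgebraicTopology.AlternatingFaceMapComplex.obj C).shape n m (fun h' ↦ h ?_)
      simp only [ComplexShape.down_Rel] at h' ⊢
      simpa using congrArg (Nat.cast : ℕ → ℤ) h'
    | Int.ofNat _, Int.negSucc _ => rfl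
    | Int.negSucc _, _ => rfl
  d_comp_d' s s' s'' _ _ := by
    match s, s', s'' with
    | Int.ofNat n, Int.ofNat m, Int.ofNat l =>
      exact (AlgebraicTopology.AlternatingFaceMapComplex.obj C).d_comp_d n m l
    | Int.ofNat _, Int.ofNat _, Int.negSucc _ => exact comp_zero
    | Int.ofNat _, Int.negSucc _, _ => exact zero_comp
    | Int.negSucc _, _, _ => exact zero_comp

/-- The components of a simplicial map on the (extended) alternating sum complexes. -/
noncomputable def altMap {C D : SimplicialObject 𝒯} (f : C ⟶ D) :
    ∀ s : ℤ, (altComplex C).X s ⟶ (altComplex D).X s := fun s ↦ match s with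
  | Int.ofNat n => f.app (Opposite.op ⦋n⦌)
  | Int.negSucc _ => 0

end AltComplex

variable [HasZeroObject 𝒯] [HasShift 𝒯 ℤ] [∀ n : ℤ, (shiftFunctor 𝒯 n).Additive]
  [Pretriangulated 𝒯]

section Exactness

variable {P Q R S : 𝒯} {f : P ⟶ Q} {g : Q ⟶ R} {h : R ⟶ P⟦(1 : ℤ)⟧}

lemma yoneda_exact_shift (hT : Triangle.mk f g h ∈ distTriang 𝒯) (n : ℤ)
    {b : Q⟦n⟧ ⟶ S} (hb : f⟦n⟧' ≫ b = 0) : ∃ c : R⟦n⟧ ⟶ S, g⟦n⟧' ≫ c = b := by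
  obtain ⟨c, hc⟩ : ∃ c : R⟦n⟧ ⟶ S, b = (n.negOnePow • g⟦n⟧') ≫ c :=
    Triangle.yoneda_exact₂ _ (Triangle.shift_distinguished _ hT n) b
      (show (n.negOnePow • f⟦n⟧') ≫ b = 0 by rw [Linear.units_smul_comp, hb, smul_zero])
  exact ⟨n.negOnePow • c, by rw [hc, Linear.units_smul_comp, Linear.comp_units_smul]⟩

lemma coyoneda_exact_shift (hT : Triangle.mk f g h ∈ distTriang 𝒯) (n : ℤ)
    {b : S ⟶ Q⟦n⟧} (hb : b ≫ g⟦n⟧' = 0) : ∃ c : S ⟶ P⟦n⟧, c ≫ f⟦n⟧' = b := by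
  obtain ⟨c, hc⟩ : ∃ c : S ⟶ P⟦n⟧, b = c ≫ (n.negOnePow • f⟦n⟧') :=
    Triangle.coyoneda_exact₂ _ (Triangle.shift_distinguished _ hT n) b
      (show b ≫ (n.negOnePow • g⟦n⟧') = 0 by rw [Linear.comp_units_smul, hb, smul_zero])
  exact ⟨n.negOnePow • c, by rw [hc, Linear.units_smul_comp, Linear.comp_units_smul]⟩

end Exactness

variable [HasCoproductsOfShape ℕ 𝒯]

/-- The map `1 - shift : ∐ T_n ⟶ ∐ T_n` whose cone is the homotopy colimit of the `T_n`,
`n ≥ 0`. -/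
noncomputable def oneSubShift (T : ℤ ⥤ 𝒯) :
    (∐ fun n : ℕ ↦ T.obj n) ⟶ (∐ fun n : ℕ ↦ T.obj n) :=
  Sigma.desc fun n : ℕ ↦ Sigma.ι (fun n : ℕ ↦ T.obj n) n -
    T.map (homOfLE (show (n : ℤ) ≤ ((n + 1 : ℕ) : ℤ) by omega)) ≫
      Sigma.ι (fun n : ℕ ↦ T.obj n) (n + 1)

/-- A totalization of a simplicial object `C` of a triangulated category (such as the homotopy
category of a stable model category): skeleta `0 = T_{-1} ⟶ T_0 ⟶ T_1 ⟶ ⋯`, where `T_{s+1}` is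
the cone of a map `Σ^s C_{s+1} ⟶ T_s` that lifts `Σ^s d : Σ^s C_{s+1} ⟶ Σ^s C_s`, together
with their homotopy colimit. -/
structure Totalization (C : SimplicialObject 𝒯) where
  /-- the skeleton `T_s` -/
  skel : ℤ ⥤ 𝒯
  isZero_skel : ∀ s : ℤ, s < 0 → IsZero (skel.obj s)
  /-- the attaching map `Σ^s C_{s+1} ⟶ T_s` -/
  attach : ∀ (s s' : ℤ) (_ : s + 1 = s'), ((altComplex C).X s')⟦s⟧ ⟶ skel.obj s
  /-- the projection `T_s ⟶ T_s / T_{s-1} = Σ^s C_s` -/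
  proj : ∀ s : ℤ, skel.obj s ⟶ ((altComplex C).X s)⟦s⟧
  attach_proj : ∀ (s s' : ℤ) (h : s + 1 = s'),
    attach s s' h ≫ proj s = ((altComplex C).d s' s)⟦s⟧'
  distinguished : ∀ (s s' : ℤ) (h : s + 1 = s'),
    Triangle.mk (attach s s' h) (skel.map (homOfLE (show s ≤ s' by omega)))
      (proj s' ≫ (shiftFunctorAdd' 𝒯 s 1 s' h).hom.app _) ∈ distTriang 𝒯
  /-- the total object -/
  tot : 𝒯
  /-- the structure map to the homotopy colimit -/
  incl : (∐ fun n : ℕ ↦ skel.obj n) ⟶ tot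
  /-- the connecting map of the homotopy colimit -/
  conn : tot ⟶ (∐ fun n : ℕ ↦ skel.obj n)⟦(1 : ℤ)⟧
  distinguished_tot : Triangle.mk (oneSubShift skel) incl conn ∈ distTriang 𝒯

namespace Totalization

variable {C D : SimplicialObject 𝒯}

/-- The structure map `T_s ⟶ Tot C`. -/
noncomputable def toTot (X : Totalization C) : ∀ s : ℤ, X.skel.obj s ⟶ X.tot := fun s ↦ match s with
  | Int.ofNat n => Sigma.ι (fun n : ℕ ↦ X.skel.obj n) n ≫ X.incl
  | Int.negSucc _ => 0

/-- The tower of subquotients `U_j = T_j / T_{i-1}`, which are the totalizations of the pieces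
`C_j ⟶ ⋯ ⟶ C_i`: each `U_j` is a cone of `T_{i-1} ⟶ T_j`, and `U_{s+1}` is the cone of the
attaching map `Σ^s C_{s+1} ⟶ T_s ⟶ U_s`, compatibly with the triangles of the skeleta (the
compatibilities provided by the octahedral axiom). -/
structure Subquotient (X : Totalization C) (i : ℤ) where
  obj : ℤ ⥤ 𝒯
  isZero_obj : ∀ j : ℤ, j < i → IsZero (obj.obj j)
  /-- the quotient maps `T_j ⟶ T_j / T_{i-1}` -/
  quot : X.skel ⟶ obj
  /-- the connecting maps of the triangles `T_{i-1} ⟶ T_j ⟶ U_j` -/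
  conn : ∀ (j : ℤ) (_ : i ≤ j), obj.obj j ⟶ (X.skel.obj (i - 1))⟦(1 : ℤ)⟧
  distinguished_quot : ∀ (j : ℤ) (h : i ≤ j),
    Triangle.mk (X.skel.map (homOfLE (show i - 1 ≤ j by omega))) (quot.app j) (conn j h) ∈
      distTriang 𝒯
  map_conn : ∀ (j j' : ℤ) (h : i ≤ j) (h' : j ≤ j'),
    obj.map (homOfLE h') ≫ conn j' (h.trans h') = conn j h
  /-- the projection `U_s ⟶ U_s / U_{s-1} = Σ^s C_s` -/
  proj : ∀ (s : ℤ) (_ : i ≤ s), obj.obj s ⟶ ((altComplex C).X s)⟦s⟧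
  quot_proj : ∀ (s : ℤ) (h : i ≤ s), quot.app s ≫ proj s h = X.proj s
  distinguished : ∀ (s s' : ℤ) (h : s + 1 = s') (h' : i ≤ s'),
    Triangle.mk (X.attach s s' h ≫ quot.app s) (obj.map (homOfLE (show s ≤ s' by omega)))
      (proj s' h' ≫ (shiftFunctorAdd' 𝒯 s 1 s' h).hom.app _) ∈ distTriang 𝒯

/-- The attaching map `Σ^s C_{s+1} ⟶ U_s` of the tower of subquotients. -/
noncomputable def Subquotient.attach {X : Totalization C} {i : ℤ} (U : X.Subquotient i) (s s' : ℤ)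
    (h : s + 1 = s') : ((altComplex C).X s')⟦s⟧ ⟶ U.obj.obj s :=
  X.attach s s' h ≫ U.quot.app s

/-- A filtration-preserving map `U_m ⟶ V_m` between the totalizations of the pieces with
simplicial degrees `i, …, m` of `C` and `D` which on the subquotients `Σ^s C_s ⟶ Σ^s D_s` agrees
with the simplicial map `f`. -/
structure FilteredMap {X : Totalization C} {Y : Totalization D} (f : C ⟶ D) {i : ℤ}
    (U : X.Subquotient i) (V : Y.Subquotient i) (m : ℤ) where
  app : ∀ (s : ℤ) (_ : i ≤ s) (_ : s ≤ m), U.obj.obj s ⟶ V.obj.obj s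
  comm_map : ∀ (s s' : ℤ) (h : s + 1 = s') (hs : i ≤ s) (hs' : s' ≤ m),
    U.obj.map (homOfLE (show s ≤ s' by omega)) ≫ app s' (by omega) hs' =
      app s hs (by omega) ≫ V.obj.map (homOfLE (show s ≤ s' by omega))
  comm_proj : ∀ (s : ℤ) (hs : i ≤ s) (hs' : s ≤ m),
    U.proj s hs ≫ (altMap f s)⟦s⟧' = app s hs hs' ≫ V.proj s hs
  comm_attach : ∀ (s s' : ℤ) (h : s + 1 = s') (hs : i ≤ s) (hs' : s' ≤ m),
    U.attach s s' h ≫ app s hs (by omega) = (altMap f s')⟦s⟧' ≫ V.attach s s' h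

/-- The Toda bracket `T(N, i; f)`, a set of maps `Σ^{N-1} C_{i+N} ⟶ D_i`.

A filtration-preserving map `φ` on the pieces with degrees `i, …, i + N - 1` (that is, a choice
of null-homotopies which kill the lower brackets in this range) gives two maps from
`Σ^{i+N-1} C_{i+N}` to the totalization `V_{i+N-1}` of the piece of `D`, through the attaching
map of `C` and through that of `D`.  The bracket consists of the maps `τ` such that `Σ^i τ`,
followed by the inclusion of `Σ^i D_i = V_i`, is the difference of the two. -/
def todaBracket (X : Totalization C) (Y : Totalization D) (f : C ⟶ D) (N : ℕ) (hN : 2 ≤ N)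
    (i : ℕ) : Set ((C _⦋i + N⦌)⟦(N : ℤ) - 1⟧ ⟶ D _⦋i⦌) :=
  {τ | ∃ (U : X.Subquotient i) (V : Y.Subquotient i) (φ : FilteredMap f U V (i + N - 1))
      (θ : ((altComplex C).X ((i + N : ℕ) : ℤ))⟦(i + N - 1 : ℤ)⟧ ⟶ V.obj.obj i),
    θ ≫ V.proj i le_rfl =
      (shiftFunctorAdd' 𝒯 ((N : ℤ) - 1) i (i + N - 1) (by omega)).hom.app (C _⦋i + N⦌) ≫
        τ⟦(i : ℤ)⟧' ∧
    θ ≫ V.obj.map (homOfLE (show (i : ℤ) ≤ i + N - 1 by omega)) =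
      U.attach (i + N - 1) ((i + N : ℕ) : ℤ) (by push_cast; omega) ≫
          φ.app (i + N - 1) (by omega) le_rfl -
        (altMap f ((i + N : ℕ) : ℤ))⟦(i + N - 1 : ℤ)⟧' ≫
          V.attach (i + N - 1) ((i + N : ℕ) : ℤ) (by push_cast; omega)}

/-- The grading of the cohomological spectral sequence: `d_r` has bidegree `(r, r - 1)`. -/
def cohGrading : CoupleGrading where
  fil p := p.1
  jdeg p := p.2 - p.1 + 1
  kdeg p := p.2 - p.1
  shift r := (r, r - 1)
  fil_shift _ _ := rfl
  jdeg_shift p r := by simp; omega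

/-- The grading of the homological spectral sequence: `d^r` has bidegree `(-r, 1 - r)`. -/
def homGrading : CoupleGrading where
  fil p := -p.1
  jdeg p := p.2 - p.1
  kdeg p := p.2 - p.1 + 1
  shift r := (-r, 1 - r)
  fil_shift p r := by simp; omega
  jdeg_shift p r := by simp; omega

section Maps

variable (X : Totalization C)

/-- The map `Σ^t C_{s'} ⟶ Σ^n T_s` given by the attaching map, for `s' = s + 1`, `t = s + n`. -/
noncomputable def attachShift (s s' n t : ℤ) (h : s + 1 = s') (ht : s + n = t) :
    ((altComplex C).X s')⟦t⟧ ⟶ (X.skel.obj s)⟦n⟧ :=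
  (shiftFunctorAdd' 𝒯 s n t ht).hom.app _ ≫ (X.attach s s' h)⟦n⟧'

/-- The map `Σ^n T_s ⟶ Σ^t C_{s'}` given by the projection, for `s' = s`, `t = s + n`. -/
noncomputable def projShift (s s' n t : ℤ) (h : s = s') (ht : s' + n = t) :
    (X.skel.obj s)⟦n⟧ ⟶ ((altComplex C).X s')⟦t⟧ :=
  (X.skel.map (homOfLE h.le) ≫ X.proj s')⟦n⟧' ≫ (shiftFunctorAdd' 𝒯 s' n t ht).inv.app _

/-- The map `Σ^n T_s ⟶ Σ^n T_{s'}`. -/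
noncomputable def skelShift {s s' : ℤ} (h : s ≤ s') (n : ℤ) :
    (X.skel.obj s)⟦n⟧ ⟶ (X.skel.obj s')⟦n⟧ := (X.skel.map (homOfLE h))⟦n⟧'

variable {X}

lemma projShift_eq (s n t : ℤ) (ht : s + n = t) :
    X.projShift s s n t rfl ht = (X.proj s)⟦n⟧' ≫ (shiftFunctorAdd' 𝒯 s n t ht).inv.app _ := by
  simp [projShift]

lemma attach_skel (s s' n t : ℤ) (h : s + 1 = s') (ht : s + n = t) :
    X.attachShift s s' n t h ht ≫ X.skelShift (show s ≤ s' by omega) n = 0 := by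
  have : X.attach s s' h ≫ X.skel.map (homOfLE (show s ≤ s' by omega)) = 0 :=
    comp_distTriang_mor_zero₁₂ _ (X.distinguished s s' h)
  rw [attachShift, skelShift, assoc, ← Functor.map_comp, this, Functor.map_zero, comp_zero]

lemma skel_proj (s s' n t : ℤ) (h : s + 1 = s') (ht : s' + n = t) :
    X.skelShift (show s ≤ s' by omega) n ≫ X.projShift s' s' n t rfl ht = 0 := by
  have : X.skel.map (homOfLE (show s ≤ s' by omega)) ≫
      X.proj s' ≫ (shiftFunctorAdd' 𝒯 s 1 s' h).hom.app _ = 0 :=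
    comp_distTriang_mor_zero₂₃ _ (X.distinguished s s' h)
  rw [← assoc, ← cancel_mono ((shiftFunctorAdd' 𝒯 s 1 s' h).inv.app _), assoc, assoc,
    Iso.hom_inv_id_app, zero_comp, comp_id] at this
  rw [projShift_eq, skelShift, ← Functor.map_comp_assoc, this, Functor.map_zero, zero_comp]

lemma proj_attach_aux (s s' n n' t : ℤ) (h : s + 1 = s') (ht : s' + n = t) (hn : n + 1 = n') :
    X.projShift s' s' n t rfl ht ≫ X.attachShift s s' n' t h (by omega) ≫
        (shiftFunctorAdd' 𝒯 1 n n' (by omega)).hom.app _ =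
      (X.proj s' ≫ (shiftFunctorAdd' 𝒯 s 1 s' h).hom.app _)⟦n⟧' ≫
        ((X.attach s s' h)⟦(1 : ℤ)⟧')⟦n⟧' := by
  have := shiftFunctorAdd'_assoc_hom_app s 1 n s' n' t h (by omega) (by omega)
    ((altComplex C).X s')
  rw [projShift_eq, attachShift, assoc, assoc, NatTrans.naturality]
  dsimp
  rw [← reassoc_of% this, Iso.inv_hom_id_app_assoc]
  simp

lemma proj_attach (s s' n n' t : ℤ) (h : s + 1 = s') (ht : s' + n = t) (hn : n + 1 = n') :
    X.projShift s' s' n t rfl ht ≫ X.attachShift s s' n' t h (by omega) = 0 := by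
  rw [← cancel_mono ((shiftFunctorAdd' 𝒯 1 n n' (by omega)).hom.app _), assoc,
    proj_attach_aux s s' n n' t h ht hn, ← Functor.map_comp]
  have : (X.proj s' ≫ (shiftFunctorAdd' 𝒯 s 1 s' h).hom.app _) ≫ (X.attach s s' h)⟦(1 : ℤ)⟧' = 0 :=
    comp_distTriang_mor_zero₃₁ _ (X.distinguished s s' h)
  rw [this, Functor.map_zero, zero_comp]

lemma shift_aux (s s' n n' t : ℤ) (h : s + 1 = s') (ht : s' + n = t) (hn : n + 1 = n') :
    X.attachShift s s' n' t h (by omega) ≫ (shiftFunctorAdd' 𝒯 1 n n' (by omega)).hom.app _ =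
      (shiftFunctorAdd' 𝒯 s' n t ht).hom.app _ ≫
        ((shiftFunctorAdd' 𝒯 s 1 s' h).hom.app _)⟦n⟧' ≫ ((X.attach s s' h)⟦(1 : ℤ)⟧')⟦n⟧' := by
  have := shiftFunctorAdd'_assoc_hom_app s 1 n s' n' t h (by omega) (by omega)
    ((altComplex C).X s')
  rw [attachShift, assoc, NatTrans.naturality]
  dsimp
  rw [← reassoc_of% this]

variable {S : 𝒯}

lemma yoneda_exact_attach (s r s' n t : ℤ) (h : s + 1 = s') (ht : s + n = t) (hr : r = s')
    (b : (X.skel.obj s)⟦n⟧ ⟶ S) :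
    X.attachShift s s' n t h ht ≫ b = 0 ↔
      ∃ c : (X.skel.obj r)⟦n⟧ ⟶ S, X.skelShift (show s ≤ r by omega) n ≫ c = b := by
  subst hr
  constructor
  · intro hb
    rw [attachShift, assoc, Preadditive.IsIso.comp_left_eq_zero] at hb
    exact yoneda_exact_shift (X.distinguished s r h) n hb
  · rintro ⟨c, rfl⟩
    rw [← assoc, attach_skel, zero_comp]

lemma yoneda_exact_skel (s r s' n t : ℤ) (h : s + 1 = s') (ht : s' + n = t) (hr : r = s')
    (c : (X.skel.obj r)⟦n⟧ ⟶ S) :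
    X.skelShift (show s ≤ r by omega) n ≫ c = 0 ↔
      ∃ x : ((altComplex C).X s')⟦t⟧ ⟶ S, X.projShift r s' n t hr ht ≫ x = c := by
  subst hr
  constructor
  · intro hc
    obtain ⟨x, hx⟩ : ∃ x, (X.proj r ≫ (shiftFunctorAdd' 𝒯 s 1 r h).hom.app _)⟦n⟧' ≫ x = c :=
      yoneda_exact_shift (rot_of_distTriang _ (X.distinguished s r h)) n hc
    refine ⟨(shiftFunctorAdd' 𝒯 r n t ht).hom.app _ ≫
      ((shiftFunctorAdd' 𝒯 s 1 r h).hom.app _)⟦n⟧' ≫ x, ?_⟩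
    rw [← hx, projShift_eq]
    simp
  · rintro ⟨x, rfl⟩
    rw [← assoc, skel_proj s r n t h, zero_comp]

lemma yoneda_exact_proj (s r s' n n' t : ℤ) (h : s + 1 = s') (ht : s' + n = t)
    (hn : n + 1 = n') (hr : r = s') (x : ((altComplex C).X s')⟦t⟧ ⟶ S) :
    X.projShift r s' n t hr ht ≫ x = 0 ↔
      ∃ b : (X.skel.obj s)⟦n'⟧ ⟶ S, X.attachShift s s' n' t h (by omega) ≫ b = x := by
  subst hr
  constructor
  · intro hx
    obtain ⟨e, he⟩ : ∃ e : ((X.skel.obj s)⟦(1 : ℤ)⟧)⟦n⟧ ⟶ S,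
        (-((X.attach s r h)⟦(1 : ℤ)⟧'))⟦n⟧' ≫ e =
          ((shiftFunctorAdd' 𝒯 s 1 r h).inv.app _)⟦n⟧' ≫
            (shiftFunctorAdd' 𝒯 r n t ht).inv.app _ ≫ x := by
      refine yoneda_exact_shift
        (rot_of_distTriang _ (rot_of_distTriang _ (X.distinguished s r h))) n ?_
      change (X.proj r ≫ (shiftFunctorAdd' 𝒯 s 1 r h).hom.app _)⟦n⟧' ≫ _ = 0
      rw [projShift_eq, assoc] at hx
      rw [← Functor.map_comp_assoc, assoc, Iso.hom_inv_id_app, comp_id, hx]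
    refine ⟨-((shiftFunctorAdd' 𝒯 1 n n' (by omega)).hom.app _ ≫ e), ?_⟩
    rw [Functor.map_neg, Preadditive.neg_comp] at he
    rw [Preadditive.comp_neg, ← assoc, shift_aux s r n n' t h ht hn, assoc, assoc,
      ← Preadditive.comp_neg, ← Preadditive.comp_neg, he, ← Functor.map_comp_assoc,
      Iso.hom_inv_id_app]
    rw [CategoryTheory.Functor.map_id, id_comp, Iso.hom_inv_id_app_assoc]
  · rintro ⟨b, rfl⟩
    rw [← assoc, proj_attach s r n n' t h ht hn, zero_comp]

lemma coyoneda_exact_attach (s r s' n t : ℤ) (h : s + 1 = s') (ht : s + n = t) (hr : r = s')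
    (b : S ⟶ (X.skel.obj s)⟦n⟧) :
    b ≫ X.skelShift (show s ≤ r by omega) n = 0 ↔
      ∃ x : S ⟶ ((altComplex C).X s')⟦t⟧, x ≫ X.attachShift s s' n t h ht = b := by
  subst hr
  constructor
  · intro hb
    obtain ⟨x, hx⟩ := coyoneda_exact_shift (X.distinguished s r h) n hb
    exact ⟨x ≫ (shiftFunctorAdd' 𝒯 s n t ht).inv.app _, by simp [attachShift, hx]⟩
  · rintro ⟨x, rfl⟩
    rw [assoc, attach_skel, comp_zero]

lemma coyoneda_exact_skel (s r s' n t : ℤ) (h : s + 1 = s') (ht : s' + n = t) (hr : r = s')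
    (c : S ⟶ (X.skel.obj r)⟦n⟧) :
    c ≫ X.projShift r s' n t hr ht = 0 ↔
      ∃ b : S ⟶ (X.skel.obj s)⟦n⟧, b ≫ X.skelShift (show s ≤ r by omega) n = c := by
  subst hr
  constructor
  · intro hc
    rw [projShift_eq, ← assoc, Preadditive.IsIso.comp_right_eq_zero] at hc
    exact coyoneda_exact_shift (rot_of_distTriang _ (X.distinguished s r h)) n
      (show c ≫ (X.proj r ≫ (shiftFunctorAdd' 𝒯 s 1 r h).hom.app _)⟦n⟧' = 0 by
        rw [Functor.map_comp, reassoc_of% hc, zero_comp])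
  · rintro ⟨b, rfl⟩
    rw [assoc, skel_proj s r n t h, comp_zero]

lemma coyoneda_exact_proj (s r s' n n' t : ℤ) (h : s + 1 = s') (ht : s' + n = t)
    (hn : n + 1 = n') (hr : r = s') (x : S ⟶ ((altComplex C).X s')⟦t⟧) :
    x ≫ X.attachShift s s' n' t h (by omega) = 0 ↔
      ∃ c : S ⟶ (X.skel.obj r)⟦n⟧, c ≫ X.projShift r s' n t hr ht = x := by
  subst hr
  constructor
  · intro hx
    obtain ⟨c, hc⟩ : ∃ c : S ⟶ (X.skel.obj r)⟦n⟧,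
        c ≫ (X.proj r ≫ (shiftFunctorAdd' 𝒯 s 1 r h).hom.app _)⟦n⟧' =
          x ≫ (shiftFunctorAdd' 𝒯 r n t ht).hom.app _ ≫
            ((shiftFunctorAdd' 𝒯 s 1 r h).hom.app _)⟦n⟧' := by
      refine coyoneda_exact_shift
        (rot_of_distTriang _ (rot_of_distTriang _ (X.distinguished s r h))) n ?_
      change _ ≫ (-((X.attach s r h)⟦(1 : ℤ)⟧'))⟦n⟧' = 0
      rw [Functor.map_neg, Preadditive.comp_neg, assoc, assoc, ← shift_aux s r n n' t h ht hn,
        reassoc_of% hx, zero_comp, neg_zero]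
    refine ⟨c, ?_⟩
    rw [projShift_eq, ← cancel_mono ((shiftFunctorAdd' 𝒯 r n t ht).hom.app _),
      ← cancel_mono (((shiftFunctorAdd' 𝒯 s 1 r h).hom.app _)⟦n⟧')]
    simp only [assoc, Iso.inv_hom_id_app_assoc]
    rw [← hc, Functor.map_comp]
  · rintro ⟨c, rfl⟩
    rw [assoc, proj_attach s r n n' t h ht hn, comp_zero]

end Maps

/-- The exact couple obtained from the skeletal tower and the cohomological functor
`H = [-, S]`, with `A σ n = H(Σ^n T_{σ-1})` and `E (s, t) = H(Σ^t C_s)`. -/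
noncomputable def cohCouple (X : Totalization C) (S : 𝒯) : ExactCouple.{v} cohGrading where
  A σ n := (X.skel.obj (σ - 1))⟦n⟧ ⟶ S
  E p := ((altComplex C).X p.1)⟦p.2⟧ ⟶ S
  i h n := Preadditive.leftComp S (X.skelShift (by omega) n)
  j p := Preadditive.leftComp S
    (X.attachShift (p.1 - 1) p.1 (p.2 - p.1 + 1) p.2 (by omega) (by omega))
  k p σ n hσ hn := Preadditive.leftComp S
    (X.projShift (σ - 1) p.1 n p.2 (by dsimp only [cohGrading] at hσ; omega)
      (by dsimp only [cohGrading] at hn; omega))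
  i_refl σ n a := by
    change X.skelShift _ n ≫ a = a
    simp [skelShift]
  i_trans h h' n a := by
    change X.skelShift _ n ≫ X.skelShift _ n ≫ a = X.skelShift _ n ≫ a
    rw [skelShift, skelShift, ← Functor.map_comp_assoc, ← Functor.map_comp]
    rfl
  exact_E p σ n hσ hn x := by
    dsimp only [cohGrading] at hσ hn
    refine yoneda_exact_proj _ _ _ _ _ _ ?_ ?_ ?_ ?_ x
    all_goals first | omega | (dsimp only [cohGrading]; omega)
  exact_j p σ hσ x := by
    dsimp only [cohGrading] at hσ
    refine yoneda_exact_attach _ _ _ _ _ ?_ ?_ ?_ x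
    all_goals omega
  exact_k p σ n τ hσ hn hτ x := by
    dsimp only [cohGrading] at hσ hn hτ
    refine yoneda_exact_skel _ _ _ _ _ ?_ ?_ ?_ x
    all_goals omega

/-- The exact couple obtained from the skeletal tower and the homological functor
`H = [S, -]`, with `A σ n = H(Σ^n T_{-σ})` and `E (s, t) = H(Σ^t C_s)`. -/
noncomputable def homCouple (X : Totalization C) (S : 𝒯) : ExactCouple.{v} homGrading where
  A σ n := S ⟶ (X.skel.obj (-σ))⟦n⟧
  E p := S ⟶ ((altComplex C).X p.1)⟦p.2⟧
  i h n := Preadditive.rightComp S (X.skelShift (by omega) n)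
  j p := Preadditive.rightComp S
    (X.projShift (-(-p.1)) p.1 (p.2 - p.1) p.2 (by omega) (by omega))
  k p σ n hσ hn := Preadditive.rightComp S
    (X.attachShift (-σ) p.1 n p.2 (by dsimp only [homGrading] at hσ; omega)
      (by dsimp only [homGrading] at hσ hn; omega))
  i_refl σ n a := by
    change a ≫ X.skelShift _ n = a
    simp [skelShift]
  i_trans h h' n a := by
    change (a ≫ X.skelShift _ n) ≫ X.skelShift _ n = a ≫ X.skelShift _ n
    rw [skelShift, skelShift, assoc, ← Functor.map_comp, ← Functor.map_comp]
    rfl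
  exact_E p σ n hσ hn x := by
    dsimp only [homGrading] at hσ hn
    refine coyoneda_exact_proj _ _ _ _ _ _ ?_ ?_ ?_ ?_ x
    all_goals first | omega | (dsimp only [homGrading]; omega)
  exact_j p σ hσ x := by
    dsimp only [homGrading] at hσ
    refine coyoneda_exact_skel _ _ _ _ _ ?_ ?_ ?_ x
    all_goals omega
  exact_k p σ n τ hσ hn hτ x := by
    dsimp only [homGrading] at hσ hn hτ
    refine coyoneda_exact_attach _ _ _ _ _ ?_ ?_ ?_ x
    all_goals omega

section SpectralSequences

open AlgebraicTopology.AlternatingFaceMapComplex (objD)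

variable (X : Totalization C) (Y : Totalization D) (f : C ⟶ D) (S : 𝒯)

/-- The cohomological spectral sequence of the skeletal tower, for `H = [-, S]`. -/
noncomputable def cohSS : SpectralSequence AddCommGrpCat.{v}
    (fun r ↦ ComplexShape.up' ((r, r - 1) : ℤ × ℤ)) 1 :=
  (X.cohCouple S).spectralSequence

/-- The homological spectral sequence of the skeletal tower, for `H = [S, -]`. -/
noncomputable def homSS : SpectralSequence AddCommGrpCat.{v}
    (fun r ↦ ComplexShape.up' ((-r, 1 - r) : ℤ × ℤ)) 1 :=
  (X.homCouple S).spectralSequence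

/-- `E_1^{n,t} ≅ [Σ^t C_n, S]`. -/
noncomputable def cohE₁ (n : ℕ) (t : ℤ) :
    AddCommGrpCat.of ((C _⦋n⦌)⟦t⟧ ⟶ S) ≅ ((X.cohSS S).page 1).X ((n : ℤ), t) :=
  (X.cohCouple S).pageOneIso ((n : ℤ), t)

/-- `E^1_{n,t} ≅ [S, Σ^t C_n]`. -/
noncomputable def homE₁ (n : ℕ) (t : ℤ) :
    AddCommGrpCat.of (S ⟶ (C _⦋n⦌)⟦t⟧) ≅ ((X.homSS S).page 1).X ((n : ℤ), t) :=
  (X.homCouple S).pageOneIso ((n : ℤ), t)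

/-- The assertion that `cohSS` is a spectral sequence `E_1^{s,t} = [Σ^t C_s, S]` (zero for
`s < 0`) with `d_1` induced by the alternating sum of the face maps, and that it converges
conditionally to `[Σ^{t-s} Tot C, S]`. -/
structure IsCohSkeletalSS : Prop where
  isZero : ∀ s t : ℤ, s < 0 → IsZero (((X.cohSS S).page 1).X (s, t))
  d_one : ∀ (n : ℕ) (t : ℤ) (x : (C _⦋n⦌)⟦t⟧ ⟶ S),
    (((X.cohSS S).page 1).d ((n : ℤ), t) (((n + 1 : ℕ) : ℤ), t)).hom
        ((X.cohE₁ S n t).hom.hom x) =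
      (X.cohE₁ S (n + 1) t).hom.hom ((objD C n)⟦t⟧' ≫ x)
  converges : (X.cohCouple S).ConvergesConditionallyToLimit (fun n ↦ (X.tot⟦n⟧ ⟶ S))
    (fun σ n ↦ Preadditive.leftComp S ((X.toTot (σ - 1))⟦n⟧'))

/-- `S` is compact with respect to countable coproducts: every map from `S` to a countable
coproduct is a finite sum of maps to the summands. -/
def _root_.IsCompactForCoproducts (S : 𝒯) : Prop :=
  ∀ (P : ℕ → 𝒯) (g : S ⟶ ∐ P), ∃ (F : Finset ℕ) (g' : ∀ n, S ⟶ P n),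
    g = ∑ n ∈ F, g' n ≫ Sigma.ι P n

/-- The assertion that `homSS` is a spectral sequence `E^1_{s,t} = [S, Σ^t C_s]` (zero for
`s < 0`) with `d^1` induced by the alternating sum of the face maps, and that it converges
conditionally to the colimit of the groups `[S, Σ^{t-s} T_m]`, which is `[S, Σ^{t-s} Tot C]`
if `S` is compact. -/
structure IsHomSkeletalSS : Prop where
  isZero : ∀ s t : ℤ, s < 0 → IsZero (((X.homSS S).page 1).X (s, t))
  d_one : ∀ (n : ℕ) (t : ℤ) (x : S ⟶ (C _⦋n + 1⦌)⟦t⟧),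
    (((X.homSS S).page 1).d (((n + 1 : ℕ) : ℤ), t) ((n : ℤ), t)).hom
        ((X.homE₁ S (n + 1) t).hom.hom x) =
      (X.homE₁ S n t).hom.hom (x ≫ (objD C n)⟦t⟧')
  converges : (X.homCouple S).ConvergesConditionallyToColimit
  abutment : IsCompactForCoproducts S →
    (X.homCouple S).IsColimit (fun n ↦ (S ⟶ X.tot⟦n⟧))
      (fun σ n ↦ Preadditive.rightComp S ((X.toTot (-σ))⟦n⟧'))

/-- Maps induced by `f` on the pages `E_r`, `1 ≤ r < k`, of the cohomological spectral
sequences: they commute with the differentials `d_r` (being maps of complexes), the first is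
given by the maps `[Σ^t f_n, S]`, and each one is the map induced by the preceding one on
homology.  As `[-, S]` is contravariant, they go from the pages for `D` to those for `C`. -/
structure CohPageMaps (k : ℕ) where
  hom : ∀ (r : ℤ) (hr : 1 ≤ r), r < k → ((Y.cohSS S).page r hr ⟶ (X.cohSS S).page r hr)
  hom_one : ∀ (hk : (1 : ℤ) < k) (n : ℕ) (t : ℤ) (x : (D _⦋n⦌)⟦t⟧ ⟶ S),
    ((hom 1 le_rfl hk).f ((n : ℤ), t)).hom ((Y.cohE₁ S n t).hom.hom x) =
      (X.cohE₁ S n t).hom.hom ((f.app (Opposite.op ⦋n⦌))⟦t⟧' ≫ x)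
  comm : ∀ (r : ℤ) (hr : 1 ≤ r) (hk : r + 1 < k) (p : ℤ × ℤ),
    HomologicalComplex.homologyMap (hom r hr (by omega)) p ≫ ((X.cohSS S).iso r (r + 1) p).hom =
      ((Y.cohSS S).iso r (r + 1) p).hom ≫ (hom (r + 1) (by omega) hk).f p

/-- Maps induced by `f` on the pages `E^r`, `1 ≤ r < k`, of the homological spectral
sequences: they commute with the differentials `d^r` (being maps of complexes), the first is
given by the maps `[S, Σ^t f_n]`, and each one is the map induced by the preceding one on
homology. -/
structure HomPageMaps (k : ℕ) where
  hom : ∀ (r : ℤ) (hr : 1 ≤ r), r < k → ((X.homSS S).page r hr ⟶ (Y.homSS S).page r hr)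
  hom_one : ∀ (hk : (1 : ℤ) < k) (n : ℕ) (t : ℤ) (x : S ⟶ (C _⦋n⦌)⟦t⟧),
    ((hom 1 le_rfl hk).f ((n : ℤ), t)).hom ((X.homE₁ S n t).hom.hom x) =
      (Y.homE₁ S n t).hom.hom (x ≫ (f.app (Opposite.op ⦋n⦌))⟦t⟧')
  comm : ∀ (r : ℤ) (hr : 1 ≤ r) (hk : r + 1 < k) (p : ℤ × ℤ),
    HomologicalComplex.homologyMap (hom r hr (by omega)) p ≫ ((Y.homSS S).iso r (r + 1) p).hom =
      ((X.homSS S).iso r (r + 1) p).hom ≫ (hom (r + 1) (by omega) hk).f p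

end SpectralSequences

end Totalization

end Triangulated

/-! The differential of an exact couple is a relation on the first page: `y` represents `d_r x` if
`k x` lifts through `r - 1` steps of the system to some `a` with `j a = y`. The `r`-cycles are the
domain of this relation and the `r`-boundaries are the elements related to `0`. Hence homomorphisms
on the groups `E p` that preserve the relation for `r` (`PreservesDiff`) induce a map of complexes
on `E_r`; no map of towers is needed. As `E_{r+1}` is identified with the homology of `E_r` by the
identity on representatives, the maps for successive `r` are automatically compatible
(`pageMap_comm`).

It remains to see that `f` preserves the relation for `r < k`. For `r = 1` this says that `f` is a
chain map. For `r ≥ 2` only the simplicial degrees `i, …, i + r` matter. If `0` lies in the bracket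
with `N = r`, then, since the projection of the bottom subquotient to `Σ^i D_i` is injective on maps
into it, there is a filtered map `φ` of subquotients with degrees `i, …, i + r - 1` that also
commutes with the next attaching map (`exists_filteredMap_of_zero_mem_todaBracket`). It transports
the lifts or extensions that compute `d_r`. They live on skeleta, whereas `φ` lives on the quotients
by `T_{i-1}`; `coyoneda_transfer` and `yoneda_transfer` bridge this by chasing the triangles
`T_{i-1} ⟶ T_j ⟶ T_j / T_{i-1}`. The maps `φ` for different `i` and `r` need not be compatible.

Convergence comes from the triangle defining the homotopy colimit. For `[-, S]`, the map `1 - shift`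
becomes the map whose kernel and cokernel are the limit and derived limit. For compact `S`, classes
in `[S, Σ^n ∐ T_m]` have finitely many nonzero components, which yields the colimit. For `[S, -]`
the system vanishes in positive filtration, so its limit and derived limit are trivially zero. -/

/-! ### Homology of abelian groups on representatives -/

namespace CategoryTheory.ShortComplex

/-- The class of a cycle in the concrete homology corresponds to its class in the abstract one. -/
lemma abHomologyIso_inv_mk (K : ShortComplex AddCommGrpCat.{v}) (z : K.g.hom.ker) :
    K.abHomologyIso.inv.hom (QuotientAddGroup.mk' K.abToCycles.range z) =
      K.homologyπ.hom (K.abCyclesIso.inv.hom z) :=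
  (ConcreteCategory.congr_hom (K.abLeftHomologyData.π_comp_homologyIso_inv) z)

/-- The description of `homologyMap` on representatives. -/
lemma homologyMap_abHomologyIso_inv_mk {K L : ShortComplex AddCommGrpCat.{v}} (φ : K ⟶ L)
    (z : K.g.hom.ker) (w : L.g.hom.ker) (h : φ.τ₂.hom z.1 = w.1) :
    (homologyMap φ).hom (K.abHomologyIso.inv.hom (QuotientAddGroup.mk' _ z)) =
      L.abHomologyIso.inv.hom (QuotientAddGroup.mk' _ w) := by
  rw [abHomologyIso_inv_mk, abHomologyIso_inv_mk]
  have h₁ := ConcreteCategory.congr_hom (homologyπ_naturality φ) (K.abCyclesIso.inv.hom z)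
  refine h₁.trans (congrArg L.homologyπ.hom ?_)
  -- Cycles embed in the middle term, where the two elements agree by `h`.
  apply (AddCommGrpCat.mono_iff_injective L.iCycles).1 inferInstance
  have h₂ := ConcreteCategory.congr_hom (cyclesMap_i φ) (K.abCyclesIso.inv.hom z)
  refine h₂.trans ?_
  refine (congrArg φ.τ₂.hom (K.abCyclesIso_inv_apply_iCycles z)).trans ?_
  exact h.trans (L.abCyclesIso_inv_apply_iCycles w).symm

end CategoryTheory.ShortComplex

/-! ### Maps of spectral sequences from maps preserving the relation `DiffRel` -/

namespace ExactCouple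

variable {g : CoupleGrading} (X Y : ExactCouple.{v} g) (φ : ∀ p, X.E p →+ Y.E p)

/-- The maps `φ` preserve the relation that `y` represents `d_r x`. -/
def PreservesDiff (r : ℤ) (hr : 1 ≤ r) : Prop :=
  ∀ {p q : ℤ × ℤ} (h : p + g.shift r = q) (x : X.E p) (y : X.E q),
    X.DiffRel r hr h x y → Y.DiffRel r hr h (φ p x) (φ q y)

variable {X Y φ} {r : ℤ} {hr : 1 ≤ r}

namespace PreservesDiff

lemma map_mem_cycles (H : PreservesDiff X Y φ r hr) {p : ℤ × ℤ} {x : X.E p}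
    (hx : x ∈ X.cycles r hr p) :
    φ p x ∈ Y.cycles r hr p := by
  obtain ⟨y, hy⟩ := (X.exists_diffRel_iff r hr rfl x).2 hx
  exact (Y.exists_diffRel_iff r hr rfl _).1 ⟨_, H rfl x y hy⟩

/-- Boundaries are the elements related to `0` in the position `p - g.shift r`, and `φ` preserves
both `0` and the relation. -/
lemma map_mem_boundaries (H : PreservesDiff X Y φ r hr) {p : ℤ × ℤ} {y : X.E p}
    (hy : y ∈ X.boundaries r hr p) :
    φ p y ∈ Y.boundaries r hr p := by
  have h : (p - g.shift r) + g.shift r = p := sub_add_cancel _ _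
  have := H h 0 y ((X.diffRel_zero_iff r hr h y).2 hy)
  rw [map_zero] at this
  exact (Y.diffRel_zero_iff r hr h _).1 this

end PreservesDiff

variable (H : PreservesDiff X Y φ r hr)

/-- The map induced on `r`-cycles. -/
def cyclesMap (p : ℤ × ℤ) : X.cycles r hr p →+ Y.cycles r hr p :=
  ((φ p).comp (X.cycles r hr p).subtype).codRestrict _ (fun x ↦ H.map_mem_cycles x.2)

/-- The map induced on the entry `E_r` in position `p`. -/
def pageMapAt (p : ℤ × ℤ) : X.Page r hr p →+ Y.Page r hr p :=
  QuotientAddGroup.map _ _ (cyclesMap H p) (by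
    intro x hx
    rw [AddSubgroup.mem_addSubgroupOf] at hx
    exact H.map_mem_boundaries hx)

lemma pageMapAt_toPage (p : ℤ × ℤ) (x : X.cycles r hr p) :
    pageMapAt H p (X.toPage r hr p x) = Y.toPage r hr p (cyclesMap H p x) := rfl

/-- The map of complexes induced on the `r`-th page. -/
noncomputable def pageMap : X.page r hr ⟶ Y.page r hr where
  f p := AddCommGrpCat.ofHom (pageMapAt H p)
  comm' p q h := by
    have h : p + g.shift r = q := h
    refine AddCommGrpCat.hom_ext (AddMonoidHom.ext fun x ↦ ?_)
    change ((Y.page r hr).d p q).hom (pageMapAt H p x) =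
      pageMapAt H q (((X.page r hr).d p q).hom x)
    obtain ⟨x, rfl⟩ := X.toPage_surjective r hr p x
    obtain ⟨y, hxy⟩ := X.exists_rep r hr h x
    rw [Y.page_d_apply r hr h, X.page_d_apply r hr h, X.diff_toPage r hr h x y hxy,
      pageMapAt_toPage, pageMapAt_toPage]
    exact Y.diff_toPage r hr h _ _ (H h _ _ hxy)

/-- The map of `E_{r+1}`-pages is the one induced on homology by the map of `E_r`-pages. -/
lemma pageMap_comm {r' : ℤ} {hr' : 1 ≤ r'} (H' : PreservesDiff X Y φ r' hr') (hrr' : r + 1 = r')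
    (p : ℤ × ℤ) :
    HomologicalComplex.homologyMap (pageMap H) p ≫ (Y.spectralSequence.iso r r' p hrr' hr).hom =
      (X.spectralSequence.iso r r' p hrr' hr).hom ≫ (pageMap H').f p := by
  have key {A A' B B' : AddCommGrpCat.{v}} (e : A ≅ B) (e' : A' ≅ B') (a : A ⟶ A') (b : B ⟶ B')
      (h : e.inv ≫ a = b ≫ e'.inv) : a ≫ e'.hom = e.hom ≫ b := by
    rw [← Iso.inv_comp_eq, ← assoc, h, assoc, Iso.inv_hom_id, comp_id]
  -- The inverse isomorphisms are the ones with a formula on representatives: the class of an `(r +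
  -- 1)`-cycle goes to the homology class of the same element.
  refine key _ _ _ _ ?_
  refine AddCommGrpCat.hom_ext (AddMonoidHom.ext fun x ↦ ?_)
  obtain ⟨x, rfl⟩ := X.toPage_surjective r' hr' p x
  exact ShortComplex.homologyMap_abHomologyIso_inv_mk
    ((HomologicalComplex.shortComplexFunctor _ _ p).map (pageMap H)) _ _ rfl

lemma pageMap_pageOneIso (H : PreservesDiff X Y φ 1 le_rfl) (p : ℤ × ℤ) (x : X.E p) :
    ((pageMap H).f p).hom ((X.pageOneIso p).hom.hom x) = (Y.pageOneIso p).hom.hom (φ p x) := rfl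

/-- The differential `d_1` of the first page, computed on representatives. -/
lemma page_one_d_pageOneIso {p q : ℤ × ℤ} (h : p + g.shift 1 = q) (x : X.E p) (y : X.E q)
    (hxy : X.DiffRel 1 le_rfl h x y) :
    ((X.spectralSequence.page 1).d p q).hom ((X.pageOneIso p).hom.hom x) =
      (X.pageOneIso q).hom.hom y := by
  refine (X.page_d_apply 1 le_rfl h _).trans ?_
  exact X.diff_toPage 1 le_rfl h _ _ hxy

lemma isZero_page_one (p : ℤ × ℤ) (h : Subsingleton (X.E p)) :
    IsZero ((X.spectralSequence.page 1).X p) :=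
  ((AddCommGrpCat.isZero_of_subsingleton (AddCommGrpCat.of (X.E p))).of_iso
    (X.pageOneIso p).symm)

end ExactCouple

/-! ### Chain maps, and exact sequences of suspended triangles -/

section

open scoped Simplicial

variable {𝒯 : Type u} [Category.{v} 𝒯] [Preadditive 𝒯] [HasZeroObject 𝒯]

lemma altMap_comm {C D : SimplicialObject 𝒯} (f : C ⟶ D) (s' s : ℤ) :
    altMap f s' ≫ (altComplex D).d s' s = (altComplex C).d s' s ≫ altMap f s := by
  match s', s with
  | Int.ofNat n, Int.ofNat m =>
    exact ((AlgebraicTopology.AlternatingFaceMapComplex.map f).comm n m)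
  | Int.ofNat _, Int.negSucc _ => exact comp_zero.trans zero_comp.symm
  | Int.negSucc _, _ => exact comp_zero.trans zero_comp.symm

lemma altComplex_d_succ (C : SimplicialObject 𝒯) (n : ℕ) :
    (altComplex C).d ((n + 1 : ℕ) : ℤ) (n : ℤ) =
      AlgebraicTopology.AlternatingFaceMapComplex.objD C n :=
  AlgebraicTopology.AlternatingFaceMapComplex.obj_d_eq C n

lemma isZero_altComplex_X (C : SimplicialObject 𝒯) (s : ℤ) (hs : s < 0) :
    IsZero ((altComplex C).X s) := by
  match s, hs with
  | Int.negSucc _, _ => exact isZero_zero 𝒯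

variable [HasShift 𝒯 ℤ] [∀ n : ℤ, (shiftFunctor 𝒯 n).Additive]
  [Pretriangulated 𝒯]

section Exactness

variable {P Q R S : 𝒯} {f : P ⟶ Q} {g : Q ⟶ R} {h : R ⟶ P⟦(1 : ℤ)⟧}

lemma yoneda_exact_shift₃ (hT : Triangle.mk f g h ∈ distTriang 𝒯) (n : ℤ)
    {b : R⟦n⟧ ⟶ S} (hb : g⟦n⟧' ≫ b = 0) : ∃ c : (P⟦(1 : ℤ)⟧)⟦n⟧ ⟶ S, h⟦n⟧' ≫ c = b :=
  yoneda_exact_shift (rot_of_distTriang _ hT) n hb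

lemma coyoneda_exact_shift₃ (hT : Triangle.mk f g h ∈ distTriang 𝒯) (n : ℤ)
    {b : S ⟶ R⟦n⟧} (hb : b ≫ h⟦n⟧' = 0) : ∃ c : S ⟶ Q⟦n⟧, c ≫ g⟦n⟧' = b :=
  coyoneda_exact_shift (rot_of_distTriang _ hT) n hb

lemma yoneda_exact_shift₁ (hT : Triangle.mk f g h ∈ distTriang 𝒯) (n : ℤ)
    {b : (P⟦(1 : ℤ)⟧)⟦n⟧ ⟶ S} (hb : h⟦n⟧' ≫ b = 0) :
    ∃ c : (Q⟦(1 : ℤ)⟧)⟦n⟧ ⟶ S, (f⟦(1 : ℤ)⟧')⟦n⟧' ≫ c = b := by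
  obtain ⟨c, hc⟩ : ∃ c : (Q⟦(1 : ℤ)⟧)⟦n⟧ ⟶ S, (-(f⟦(1 : ℤ)⟧'))⟦n⟧' ≫ c = b :=
    yoneda_exact_shift (rot_of_distTriang _ (rot_of_distTriang _ hT)) n hb
  exact ⟨-c, by rw [← hc, Functor.map_neg, Preadditive.neg_comp, Preadditive.comp_neg]⟩

end Exactness

variable [HasCoproductsOfShape ℕ 𝒯]

namespace Totalization

variable {C D : SimplicialObject 𝒯} {X : Totalization C} {Y : Totalization D} {f : C ⟶ D}

lemma attachShift_projShift (s s' n t : ℤ) (h : s + 1 = s') (ht : s + n = t) :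
    X.attachShift s s' n t h ht ≫ X.projShift s s n t rfl ht =
      ((altComplex C).d s' s)⟦t⟧' := by
  rw [projShift_eq, attachShift, assoc, ← Functor.map_comp_assoc, X.attach_proj]
  rw [← cancel_mono ((shiftFunctorAdd' 𝒯 s n t ht).hom.app _)]
  simp only [assoc, Iso.inv_hom_id_app]
  exact (congrArg _ (comp_id _)).trans
    ((shiftFunctorAdd' 𝒯 s n t ht).hom.naturality ((altComplex C).d s' s)).symm

lemma isZero_skelShift (s n : ℤ) (hs : s < 0) : IsZero ((X.skel.obj s)⟦n⟧) :=
  (shiftFunctor 𝒯 n).map_isZero (X.isZero_skel s hs)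

/-! ### Transporting lifts and extensions along a filtered map of subquotients -/

section Transfer

variable {i : ℤ} {U : X.Subquotient i} {V : Y.Subquotient i} {m : ℤ} (φ : FilteredMap f U V m)

/-- Induction on `m - i`, as the structure records only the squares for consecutive stages. -/
lemma FilteredMap.comm_map_of_le (hi : i ≤ m) :
    U.obj.map (homOfLE hi) ≫ φ.app m hi le_rfl =
      φ.app i le_rfl hi ≫ V.obj.map (homOfLE hi) := by
  have key (d : ℕ) : ∀ (j : ℤ) (hj : i + d = j) (hj' : j ≤ m),
      U.obj.map (homOfLE (show i ≤ j by omega)) ≫ φ.app j (by omega) hj' =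
        φ.app i le_rfl hi ≫ V.obj.map (homOfLE (show i ≤ j by omega)) := by
    induction d with
    | zero =>
      intro j hj hj'
      obtain rfl : i = j := by simpa using hj
      simp
    | succ d hd =>
      intro j hj hj'
      have e₁ : U.obj.map (homOfLE (show i ≤ j by omega)) =
          U.obj.map (homOfLE (show i ≤ j - 1 by omega)) ≫
            U.obj.map (homOfLE (show j - 1 ≤ j by omega)) := by
        rw [← Functor.map_comp]; rfl
      have e₂ : V.obj.map (homOfLE (show i ≤ j by omega)) =
          V.obj.map (homOfLE (show i ≤ j - 1 by omega)) ≫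
            V.obj.map (homOfLE (show j - 1 ≤ j by omega)) := by
        rw [← Functor.map_comp]; rfl
      rw [e₁, e₂, assoc, φ.comm_map (j - 1) j (by omega) (by omega) hj',
        reassoc_of% (hd (j - 1) (by push_cast at hj; omega) (by omega))]
  exact key (m - i).toNat m (by omega) le_rfl

variable {φ} {s' : ℤ} {h : m + 1 = s'} {hi : i ≤ m}

lemma altMap_attachShift_quot
    (hφ : U.attach m s' h ≫ φ.app m hi le_rfl = (altMap f s')⟦m⟧' ≫ V.attach m s' h)
    (n t : ℤ) (ht : m + n = t) :
    (altMap f s')⟦t⟧' ≫ Y.attachShift m s' n t h ht ≫ (V.quot.app m)⟦n⟧' =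
      X.attachShift m s' n t h ht ≫ (U.quot.app m)⟦n⟧' ≫ (φ.app m hi le_rfl)⟦n⟧' := by
  have := (shiftFunctorAdd' 𝒯 m n t ht).hom.naturality (altMap f s')
  rw [attachShift, attachShift]
  simp only [assoc]
  rw [reassoc_of% this]
  simp only [← Functor.map_comp]
  dsimp only [Subquotient.attach] at hφ
  rw [← hφ, assoc]

lemma projShift_altMap (s n t : ℤ) (ht : s + n = t) :
    X.projShift s s n t rfl ht ≫ (altMap f s)⟦t⟧' =
      (X.proj s ≫ (altMap f s)⟦s⟧')⟦n⟧' ≫ (shiftFunctorAdd' 𝒯 s n t ht).inv.app _ := by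
  have := (shiftFunctorAdd' 𝒯 s n t ht).inv.naturality (altMap f s)
  rw [projShift_eq, assoc, ← this, Functor.map_comp, assoc]
  rfl

/-- Since the projection to the bottom layer factors through `V_i = T_i / T_{i-1}`, corrections
coming from `T_{i-1}` do not affect it. -/
lemma projShift_eq_quot (V : Y.Subquotient i) (n t : ℤ) (ht : i + n = t) :
    Y.projShift i i n t rfl ht =
      (V.quot.app i)⟦n⟧' ≫ (V.proj i le_rfl)⟦n⟧' ≫ (shiftFunctorAdd' 𝒯 i n t ht).inv.app _ := by
  rw [projShift_eq, ← Functor.map_comp_assoc, V.quot_proj]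

variable {S : 𝒯}

/-- A filtered map that is compatible with the next attaching map transports lifts of classes
in `[S, Σ^n T_m]` to the `i`-th skeleton. -/
lemma coyoneda_transfer
    (hφ : U.attach m s' h ≫ φ.app m hi le_rfl = (altMap f s')⟦m⟧' ≫ V.attach m s' h)
    (n t t' : ℤ) (ht : m + n = t) (ht' : i + n = t')
    (x : S ⟶ ((altComplex C).X s')⟦t⟧) (a : S ⟶ (X.skel.obj i)⟦n⟧)
    (hax : a ≫ X.skelShift hi n = x ≫ X.attachShift m s' n t h ht) :
    ∃ b : S ⟶ (Y.skel.obj i)⟦n⟧,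
      b ≫ Y.skelShift hi n = (x ≫ (altMap f s')⟦t⟧') ≫ Y.attachShift m s' n t h ht ∧
      b ≫ Y.projShift i i n t' rfl ht' = (a ≫ X.projShift i i n t' rfl ht') ≫ (altMap f i)⟦t'⟧' := by
  set c := (x ≫ (altMap f s')⟦t⟧') ≫ Y.attachShift m s' n t h ht with hc
  set β := a ≫ (U.quot.app i)⟦n⟧' ≫ (φ.app i le_rfl hi)⟦n⟧' with hβ
  have hβc : β ≫ (V.obj.map (homOfLE hi))⟦n⟧' = c ≫ (V.quot.app m)⟦n⟧' := by
    simp only [hc, hβ, assoc]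
    rw [altMap_attachShift_quot hφ n t ht, ← reassoc_of% hax, ← Functor.map_comp,
      ← φ.comm_map_of_le hi, skelShift, Functor.map_comp,
      ← Functor.map_comp_assoc, ← Functor.map_comp_assoc]
    congr 3
    exact (U.quot.naturality (homOfLE hi)).symm
  have hcq : (V.quot.app m)⟦n⟧' ≫ (V.conn m hi)⟦n⟧' = 0 := by
    rw [← Functor.map_comp]
    have : V.quot.app m ≫ V.conn m hi = 0 :=
      comp_distTriang_mor_zero₂₃ _ (V.distinguished_quot m hi)
    rw [this, Functor.map_zero]
  -- The connecting map of `V_i` factors through `V_m`, where `β` becomes the image of `c`. That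
  -- image comes from `T_m`, so the obstruction to lifting `β` to `T_i` vanishes.
  obtain ⟨b, hb⟩ := coyoneda_exact_shift₃ (V.distinguished_quot i le_rfl) n (b := β) (by
      rw [← V.map_conn i m le_rfl hi, Functor.map_comp, reassoc_of% hβc, hcq, comp_zero])
  have hq : Y.skelShift hi n ≫ (V.quot.app m)⟦n⟧' =
      (V.quot.app i)⟦n⟧' ≫ (V.obj.map (homOfLE hi))⟦n⟧' := by
    rw [skelShift, ← Functor.map_comp, ← Functor.map_comp, V.quot.naturality]
  -- The images of `b` and `c` are known to agree only in `V_m`, so in `T_m` they differ by a class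
  -- from `T_{i-1}`.
  obtain ⟨e, he⟩ := coyoneda_exact_shift (S := S) (V.distinguished_quot m hi) n
    (b := b ≫ Y.skelShift hi n - c) (by
      rw [Preadditive.sub_comp, assoc b, hq, reassoc_of% hb, hβc, sub_self])
  have hz : Y.skelShift (show i - 1 ≤ i by omega) n ≫ (V.quot.app i)⟦n⟧' = 0 := by
    rw [skelShift, ← Functor.map_comp]
    have : Y.skel.map (homOfLE (show i - 1 ≤ i by omega)) ≫ V.quot.app i = 0 :=
      comp_distTriang_mor_zero₁₂ _ (V.distinguished_quot i le_rfl)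
    rw [this, Functor.map_zero]
  have hs : Y.skelShift (show i - 1 ≤ i by omega) n ≫ Y.skelShift hi n =
      (Y.skel.map (homOfLE (show i - 1 ≤ m by omega)))⟦n⟧' := by
    rw [skelShift, skelShift, ← Functor.map_comp, ← Functor.map_comp]; rfl
  -- The correction by `e` repairs the image in `T_m` and is invisible in `V_i`.
  refine ⟨b - e ≫ Y.skelShift (show i - 1 ≤ i by omega) n, ?_, ?_⟩
  · rw [Preadditive.sub_comp, assoc, hs, he, sub_sub_cancel]
  · rw [projShift_eq_quot V, Preadditive.sub_comp, assoc, reassoc_of% hz, zero_comp, comp_zero,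
      sub_zero, reassoc_of% hb, hβ, assoc, assoc, assoc, projShift_altMap, ← U.quot_proj i le_rfl,
      assoc (U.quot.app i), φ.comm_proj i le_rfl hi]
    simp only [Functor.map_comp, assoc]

/-- A filtered map that is compatible with the next attaching map transports extensions to
`[Σ^n T_m, S]` of classes in `[Σ^n T_i, S]` that come from the `i`-th layer. -/
lemma yoneda_transfer
    (hφ : U.attach m s' h ≫ φ.app m hi le_rfl = (altMap f s')⟦m⟧' ≫ V.attach m s' h)
    (n t t' : ℤ) (ht : m + n = t) (ht' : i + n = t')
    (x : ((altComplex D).X i)⟦t'⟧ ⟶ S) (a : (Y.skel.obj m)⟦n⟧ ⟶ S)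
    (hax : Y.skelShift hi n ≫ a = Y.projShift i i n t' rfl ht' ≫ x) :
    ∃ b : (X.skel.obj m)⟦n⟧ ⟶ S,
      X.skelShift hi n ≫ b = X.projShift i i n t' rfl ht' ≫ (altMap f i)⟦t'⟧' ≫ x ∧
      X.attachShift m s' n t h ht ≫ b = (altMap f s')⟦t⟧' ≫ Y.attachShift m s' n t h ht ≫ a := by
  have hz : Y.skelShift (show i - 1 ≤ i by omega) n ≫ (V.quot.app i)⟦n⟧' = 0 := by
    rw [skelShift, ← Functor.map_comp]
    have : Y.skel.map (homOfLE (show i - 1 ≤ i by omega)) ≫ V.quot.app i = 0 :=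
      comp_distTriang_mor_zero₁₂ _ (V.distinguished_quot i le_rfl)
    rw [this, Functor.map_zero]
  have hs : Y.skelShift (show i - 1 ≤ i by omega) n ≫ Y.skelShift hi n =
      (Y.skel.map (homOfLE (show i - 1 ≤ m by omega)))⟦n⟧' := by
    rw [skelShift, skelShift, ← Functor.map_comp, ← Functor.map_comp]; rfl
  -- On `T_i` the map `a` factors through the bottom layer, so it vanishes on `T_{i-1}` and descends
  -- to `V_m`.
  obtain ⟨α, hα⟩ := yoneda_exact_shift (S := S) (V.distinguished_quot m hi) n (b := a) (by
    rw [← hs, assoc, hax, projShift_eq_quot V, assoc, reassoc_of% hz, zero_comp])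
  set ξ := (V.proj i le_rfl)⟦n⟧' ≫ (shiftFunctorAdd' 𝒯 i n t' ht').inv.app _ ≫ x with hξ
  have hq : Y.skelShift hi n ≫ (V.quot.app m)⟦n⟧' =
      (V.quot.app i)⟦n⟧' ≫ (V.obj.map (homOfLE hi))⟦n⟧' := by
    rw [skelShift, ← Functor.map_comp, ← Functor.map_comp, V.quot.naturality]
  -- The restriction of `α` to `V_i` agrees with the required `ξ` only after pulling back to `T_i`;
  -- the difference factors through the connecting map.
  obtain ⟨e, he⟩ := yoneda_exact_shift₃ (V.distinguished_quot i le_rfl) n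
    (b := (V.obj.map (homOfLE hi))⟦n⟧' ≫ α - ξ) (by
      rw [Preadditive.comp_sub, ← reassoc_of% hq, hα, hax, projShift_eq_quot V, hξ]
      simp)
  have hcq : (V.quot.app m)⟦n⟧' ≫ (V.conn m hi)⟦n⟧' = 0 := by
    rw [← Functor.map_comp]
    have : V.quot.app m ≫ V.conn m hi = 0 :=
      comp_distTriang_mor_zero₂₃ _ (V.distinguished_quot m hi)
    rw [this, Functor.map_zero]
  -- The connecting map of `V_m` restricts to that of `V_i` and is zero on `T_m`, so this corrects
  -- the restriction to `V_i` while `γ` still induces `a`.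
  set γ := α - (V.conn m hi)⟦n⟧' ≫ e with hγ
  have hγq : (V.quot.app m)⟦n⟧' ≫ γ = a := by
    rw [hγ, Preadditive.comp_sub, reassoc_of% hcq, zero_comp, sub_zero, hα]
  have hγξ : (V.obj.map (homOfLE hi))⟦n⟧' ≫ γ = ξ := by
    rw [hγ, Preadditive.comp_sub, ← Functor.map_comp_assoc, V.map_conn i m le_rfl hi, he,
      sub_sub_cancel]
  refine ⟨(U.quot.app m)⟦n⟧' ≫ (φ.app m hi le_rfl)⟦n⟧' ≫ γ, ?_, ?_⟩
  · have hU : X.skelShift hi n ≫ (U.quot.app m)⟦n⟧' ≫ (φ.app m hi le_rfl)⟦n⟧' =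
        (U.quot.app i)⟦n⟧' ≫ (φ.app i le_rfl hi)⟦n⟧' ≫ (V.obj.map (homOfLE hi))⟦n⟧' := by
      simp only [skelShift, ← Functor.map_comp]
      rw [← φ.comm_map_of_le hi, U.quot.naturality_assoc]
    rw [reassoc_of% hU, hγξ, hξ, ← assoc (X.projShift _ _ _ _ _ _), projShift_altMap,
      ← U.quot_proj i le_rfl, assoc (U.quot.app i), φ.comm_proj i le_rfl hi]
    simp only [Functor.map_comp, assoc]
  · rw [← hγq]
    have := altMap_attachShift_quot hφ n t ht
    rw [← reassoc_of% this]

end Transfer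

/-- If the bracket vanishes, a filtered map compatible with the next attaching map exists. -/
lemma exists_filteredMap_of_zero_mem_todaBracket (k : ℕ)
    (H : ∀ (N : ℕ) (hN : 2 ≤ N) (i : ℕ), N < k → 0 ∈ X.todaBracket Y f N hN i)
    (i m s' : ℤ) (hi₀ : 0 ≤ i) (hi : i < m) (h : m + 1 = s') (hk : s' < k + i) :
    ∃ (U : X.Subquotient i) (V : Y.Subquotient i) (φ : FilteredMap f U V m),
      U.attach m s' h ≫ φ.app m hi.le le_rfl = (altMap f s')⟦m⟧' ≫ V.attach m s' h := by
  lift i to ℕ using hi₀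
  -- The relevant bracket has `N = s' - i`: then `i < m` gives `2 ≤ N`, and `hk` gives `N < k`.
  obtain ⟨N, hN⟩ : ∃ N : ℕ, s' = ((i + N : ℕ) : ℤ) := ⟨(s' - i).toNat, by omega⟩
  subst hN
  obtain rfl : m = i + N - 1 := by push_cast at h; omega
  obtain ⟨U, V, φ, θ, hθ, hθ'⟩ := H N (by omega) i (by push_cast at hk; omega)
  refine ⟨U, V, φ, ?_⟩
  -- A map into `V_i` that dies in the bottom layer factors through `V_{i-1} = 0`.
  have hθ₀ : θ = 0 := by
    rw [Functor.map_zero, comp_zero] at hθ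
    obtain ⟨y, hy⟩ := Triangle.coyoneda_exact₃ _
      (V.distinguished (i - 1) i (by omega) le_rfl) θ
      ((assoc _ _ _).symm.trans ((congrArg (· ≫ _) hθ).trans zero_comp))
    obtain rfl : y = 0 := (V.isZero_obj _ (by omega)).eq_of_tgt _ _
    exact hy.trans zero_comp
  rw [hθ₀, zero_comp] at hθ'
  exact sub_eq_zero.1 hθ'.symm

lemma skelShift_self (s n : ℤ) (h : s ≤ s) : X.skelShift h n = 𝟙 _ := by
  simp [skelShift]

/-! ### Vanishing brackets imply that `f` preserves the differentials -/

section Preserves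

variable {S : 𝒯} (k : ℕ)

lemma altMap_attachShift_projShift (s s' n t : ℤ) (h : s + 1 = s') (ht : s + n = t) :
    (altMap f s')⟦t⟧' ≫ Y.attachShift s s' n t h ht ≫ Y.projShift s s n t rfl ht =
      X.attachShift s s' n t h ht ≫ X.projShift s s n t rfl ht ≫ (altMap f s)⟦t⟧' := by
  have := X.attachShift_projShift s s' n t h ht
  rw [attachShift_projShift, reassoc_of% this, ← Functor.map_comp, ← Functor.map_comp,
    altMap_comm]

/-- For `i = m`, which is the case of `d_1`, the chain map property suffices and no bracket enters;
for `i < m` the filtered map does the work. -/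
lemma coyoneda_transfer_of_nonneg
    (H : ∀ (N : ℕ) (hN : 2 ≤ N) (i : ℕ), N < k → 0 ∈ X.todaBracket Y f N hN i)
    (i m s' n t t' : ℤ) (hi₀ : 0 ≤ i) (hi : i ≤ m) (h : m + 1 = s') (hk : s' < k + i)
    (ht : m + n = t) (ht' : i + n = t')
    (x : S ⟶ ((altComplex C).X s')⟦t⟧) (a : S ⟶ (X.skel.obj i)⟦n⟧)
    (hax : a ≫ X.skelShift hi n = x ≫ X.attachShift m s' n t h ht) :
    ∃ b : S ⟶ (Y.skel.obj i)⟦n⟧,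
      b ≫ Y.skelShift hi n = (x ≫ (altMap f s')⟦t⟧') ≫ Y.attachShift m s' n t h ht ∧
      b ≫ Y.projShift i i n t' rfl ht' =
        (a ≫ X.projShift i i n t' rfl ht') ≫ (altMap f i)⟦t'⟧' := by
  obtain rfl | him := hi.eq_or_lt
  · obtain rfl : t = t' := by omega
    rw [skelShift_self, comp_id] at hax
    refine ⟨(x ≫ (altMap f s')⟦t⟧') ≫ Y.attachShift i s' n t h ht, by rw [skelShift_self, comp_id],
      ?_⟩
    rw [assoc, assoc, altMap_attachShift_projShift (X := X), hax, assoc, assoc]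
  · obtain ⟨U, V, φ, hφ⟩ := exists_filteredMap_of_zero_mem_todaBracket k H i m s' hi₀ him h hk
    exact coyoneda_transfer hφ n t t' ht ht' x a hax

lemma yoneda_transfer_of_nonneg
    (H : ∀ (N : ℕ) (hN : 2 ≤ N) (i : ℕ), N < k → 0 ∈ X.todaBracket Y f N hN i)
    (i m s' n t t' : ℤ) (hi₀ : 0 ≤ i) (hi : i ≤ m) (h : m + 1 = s') (hk : s' < k + i)
    (ht : m + n = t) (ht' : i + n = t')
    (x : ((altComplex D).X i)⟦t'⟧ ⟶ S) (a : (Y.skel.obj m)⟦n⟧ ⟶ S)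
    (hax : Y.skelShift hi n ≫ a = Y.projShift i i n t' rfl ht' ≫ x) :
    ∃ b : (X.skel.obj m)⟦n⟧ ⟶ S,
      X.skelShift hi n ≫ b = X.projShift i i n t' rfl ht' ≫ (altMap f i)⟦t'⟧' ≫ x ∧
      X.attachShift m s' n t h ht ≫ b =
        (altMap f s')⟦t⟧' ≫ Y.attachShift m s' n t h ht ≫ a := by
  obtain rfl | him := hi.eq_or_lt
  · obtain rfl : t = t' := by omega
    rw [skelShift_self, id_comp] at hax
    refine ⟨X.projShift i i n t rfl ht ≫ (altMap f i)⟦t⟧' ≫ x, by rw [skelShift_self, id_comp], ?_⟩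
    have := altMap_attachShift_projShift (X := X) (Y := Y) (f := f) i s' n t h ht
    rw [hax, reassoc_of% this]
  · obtain ⟨U, V, φ, hφ⟩ := exists_filteredMap_of_zero_mem_todaBracket k H i m s' hi₀ him h hk
    exact yoneda_transfer hφ n t t' ht ht' x a hax

/-- The form in which vanishing of the brackets is used for `H = [S, -]`. -/
lemma coyoneda_transfer_of_todaBracket
    (H : ∀ (N : ℕ) (hN : 2 ≤ N) (i : ℕ), N < k → 0 ∈ X.todaBracket Y f N hN i)
    (i i' m s' n t t' : ℤ) (hi : i' ≤ m) (hii' : i' = i) (h : m + 1 = s') (hk : s' < k + i)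
    (ht : m + n = t) (ht' : i + n = t')
    (x : S ⟶ ((altComplex C).X s')⟦t⟧) (a : S ⟶ (X.skel.obj i')⟦n⟧)
    (hax : a ≫ X.skelShift hi n = x ≫ X.attachShift m s' n t h ht) :
    ∃ b : S ⟶ (Y.skel.obj i')⟦n⟧,
      b ≫ Y.skelShift hi n = (x ≫ (altMap f s')⟦t⟧') ≫ Y.attachShift m s' n t h ht ∧
      b ≫ Y.projShift i' i n t' hii' ht' =
        (a ≫ X.projShift i' i n t' hii' ht') ≫ (altMap f i)⟦t'⟧' := by
  subst hii'
  by_cases hi₀ : 0 ≤ i'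
  · exact coyoneda_transfer_of_nonneg k H i' m s' n t t' hi₀ hi h hk ht ht' x a hax
  obtain rfl : a = 0 := (isZero_skelShift _ _ (by omega)).eq_of_tgt _ _
  rw [zero_comp] at hax
  refine ⟨0, ?_, by simp⟩
  -- As `T_i = 0`, the transported class has to vanish. For `m ≥ 0`, transferring `a = 0` at
  -- filtration `0` gives a lift to `T_0` that dies in `Σ^n D_0`, so it comes from `T_{-1} = 0`. The
  -- bound `hk` passes from `i` to `0` because `i` is negative.
  by_cases hm : 0 ≤ m
  · obtain ⟨b, hb, hb'⟩ := coyoneda_transfer_of_nonneg k H 0 m s' n t n le_rfl hm h (by omega) ht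
      (by omega) x 0 (by rw [zero_comp, hax])
    rw [zero_comp, zero_comp] at hb'
    obtain ⟨c, rfl⟩ := (coyoneda_exact_skel (-1) 0 0 n n (by omega) (by omega) rfl b).1 hb'
    obtain rfl : c = 0 := (isZero_skelShift _ _ (by omega)).eq_of_tgt _ _
    rw [← hb, zero_comp, zero_comp, zero_comp]
  · exact (isZero_skelShift _ _ (by omega)).eq_of_tgt _ _

/-- The form in which vanishing of the brackets is used for `H = [-, S]`. -/
lemma yoneda_transfer_of_todaBracket
    (H : ∀ (N : ℕ) (hN : 2 ≤ N) (i : ℕ), N < k → 0 ∈ X.todaBracket Y f N hN i)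
    (i i' m s' n t t' : ℤ) (hi : i' ≤ m) (hii' : i' = i) (h : m + 1 = s') (hk : s' < k + i)
    (ht : m + n = t) (ht' : i + n = t')
    (x : ((altComplex D).X i)⟦t'⟧ ⟶ S) (a : (Y.skel.obj m)⟦n⟧ ⟶ S)
    (hax : Y.skelShift hi n ≫ a = Y.projShift i' i n t' hii' ht' ≫ x) :
    ∃ b : (X.skel.obj m)⟦n⟧ ⟶ S,
      X.skelShift hi n ≫ b = X.projShift i' i n t' hii' ht' ≫ (altMap f i)⟦t'⟧' ≫ x ∧
      X.attachShift m s' n t h ht ≫ b =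
        (altMap f s')⟦t⟧' ≫ Y.attachShift m s' n t h ht ≫ a := by
  subst hii'
  by_cases hi₀ : 0 ≤ i'
  · exact yoneda_transfer_of_nonneg k H i' m s' n t t' hi₀ hi h hk ht ht' x a hax
  by_cases hm : 0 ≤ m
  -- Because `T_{-1} = 0`, the restriction of `a` to `T_0` comes from some `y` on the layer `Σ^n
  -- D_0`, and the transfer at filtration `0` applies to `y`.
  · obtain ⟨y, hy⟩ := (yoneda_exact_skel (-1) 0 0 n n (by omega) (by omega) rfl
      (Y.skelShift hm n ≫ a)).1 ((isZero_skelShift _ _ (by omega)).eq_of_src _ _)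
    obtain ⟨b, -, hb⟩ := yoneda_transfer_of_nonneg k H 0 m s' n t n le_rfl hm h (by omega) ht
      (by omega) y a hy.symm
    exact ⟨b, (isZero_skelShift _ _ (by omega)).eq_of_src _ _, hb⟩
  · refine ⟨0, (isZero_skelShift _ _ (by omega)).eq_of_src _ _, ?_⟩
    have : Y.attachShift m s' n t h ht = 0 := (isZero_skelShift _ _ (by omega)).eq_of_tgt _ _
    rw [this, comp_zero, zero_comp, comp_zero]

variable (X Y f S)

/-- The map `[Σ^t D_s, S] ⟶ [Σ^t C_s, S]` induced by `f`. -/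
noncomputable def cohMap (p : ℤ × ℤ) : (Y.cohCouple S).E p →+ (X.cohCouple S).E p :=
  Preadditive.leftComp S ((shiftFunctor 𝒯 p.2).map (altMap f p.1))

/-- The map `[S, Σ^t C_s] ⟶ [S, Σ^t D_s]` induced by `f`. -/
noncomputable def homMap (p : ℤ × ℤ) : (X.homCouple S).E p →+ (Y.homCouple S).E p :=
  Preadditive.rightComp S ((shiftFunctor 𝒯 p.2).map (altMap f p.1))

variable {X Y f}

lemma preservesDiff_cohMap
    (H : ∀ (N : ℕ) (hN : 2 ≤ N) (i : ℕ), N < k → 0 ∈ X.todaBracket Y f N hN i)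
    (r : ℤ) (hr : 1 ≤ r) (hk : r < k) :
    ExactCouple.PreservesDiff (Y.cohCouple S) (X.cohCouple S) (X.cohMap Y f S) r hr := by
  rintro p q h x _ ⟨a, ha, rfl⟩
  have h₁ : p.1 + r = q.1 := congrArg Prod.fst h
  have h₂ : p.2 + (r - 1) = q.2 := congrArg Prod.snd h
  -- Here `s' - i = q.1 - p.1 = r`, so the bound `s' < k + i` is `r < k`. The index `p.1 + 1 - 1` is
  -- the form in which the couple presents the `p.1`-th skeleton.
  obtain ⟨b, hb⟩ := yoneda_transfer_of_todaBracket k H p.1 (p.1 + 1 - 1) (q.1 - 1) q.1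
    (q.2 - q.1 + 1) q.2 p.2 (by omega) (by omega) (by omega) (by omega) (by omega) (by omega)
    x a ha
  exact ⟨b, hb⟩

lemma preservesDiff_homMap
    (H : ∀ (N : ℕ) (hN : 2 ≤ N) (i : ℕ), N < k → 0 ∈ X.todaBracket Y f N hN i)
    (r : ℤ) (hr : 1 ≤ r) (hk : r < k) :
    ExactCouple.PreservesDiff (X.homCouple S) (Y.homCouple S) (X.homMap Y f S) r hr := by
  rintro p q h x _ ⟨a, ha, rfl⟩
  have h₁ : p.1 + (-r) = q.1 := congrArg Prod.fst h
  have h₂ : p.2 + (1 - r) = q.2 := congrArg Prod.snd h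
  obtain ⟨b, hb⟩ := coyoneda_transfer_of_todaBracket k H q.1 (-(-q.1)) (-(-p.1 + 1)) p.1
    (q.2 - q.1) p.2 q.2 (by omega) (by omega) (by omega) (by omega) (by omega) (by omega)
    x a ha
  exact ⟨b, hb⟩

/-- The maps of pages for `H = [-, S]`. -/
noncomputable def cohPageMaps
    (H : ∀ (N : ℕ) (hN : 2 ≤ N) (i : ℕ), N < k → 0 ∈ X.todaBracket Y f N hN i) :
    X.CohPageMaps Y f S k where
  hom r hr hk := ExactCouple.pageMap (preservesDiff_cohMap S k H r hr hk)
  hom_one hk n t x :=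
    ExactCouple.pageMap_pageOneIso (preservesDiff_cohMap S k H 1 le_rfl hk) ((n : ℤ), t) x
  comm r hr hk p := ExactCouple.pageMap_comm (preservesDiff_cohMap S k H r hr (by omega))
    (preservesDiff_cohMap S k H (r + 1) (by omega) hk) rfl p

/-- The maps of pages for `H = [S, -]`. -/
noncomputable def homPageMaps
    (H : ∀ (N : ℕ) (hN : 2 ≤ N) (i : ℕ), N < k → 0 ∈ X.todaBracket Y f N hN i) :
    X.HomPageMaps Y f S k where
  hom r hr hk := ExactCouple.pageMap (preservesDiff_homMap S k H r hr hk)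
  hom_one hk n t x :=
    ExactCouple.pageMap_pageOneIso (preservesDiff_homMap S k H 1 le_rfl hk) ((n : ℤ), t) x
  comm r hr hk p := ExactCouple.pageMap_comm (preservesDiff_homMap S k H r hr (by omega))
    (preservesDiff_homMap S k H (r + 1) (by omega) hk) rfl p

end Preserves

end Totalization

end

/-! ### Countable coproducts, the map `1 - shift` and compact objects -/

section

open scoped Simplicial

variable {𝒯 : Type u} [Category.{v} 𝒯] [HasCoproductsOfShape ℕ 𝒯] {S : 𝒯}

section Coproducts

variable {P : ℕ → 𝒯} {n : ℤ}

section

variable [HasShift 𝒯 ℤ]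

/-- The shift is an equivalence, so it preserves coproducts and the comparison map is invertible. -/
lemma sigma_shift_hom_ext {w w' : (∐ P)⟦n⟧ ⟶ S}
    (h : ∀ m, (Sigma.ι P m)⟦n⟧' ≫ w = (Sigma.ι P m)⟦n⟧' ≫ w') : w = w' := by
  rw [← cancel_epi (sigmaComparison (shiftFunctor 𝒯 n) P)]
  refine Sigma.hom_ext _ _ fun m ↦ ?_
  rw [ι_comp_sigmaComparison_assoc, ι_comp_sigmaComparison_assoc, h]

lemma exists_sigma_shift_desc (a : ∀ m, (P m)⟦n⟧ ⟶ S) :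
    ∃ w : (∐ P)⟦n⟧ ⟶ S, ∀ m, (Sigma.ι P m)⟦n⟧' ≫ w = a m := by
  refine ⟨inv (sigmaComparison (shiftFunctor 𝒯 n) P) ≫ Sigma.desc a, fun m ↦ ?_⟩
  rw [← ι_comp_sigmaComparison, assoc, IsIso.hom_inv_id_assoc, Sigma.ι_desc]

end

variable [Preadditive 𝒯]

variable (P) in
/-- The projection of a coproduct to a summand. -/
noncomputable def sigmaProj (k : ℕ) : ∐ P ⟶ P k :=
  Sigma.desc fun j ↦ if h : j = k then eqToHom (by rw [h]) else 0

lemma ι_sigmaProj_self (k : ℕ) : Sigma.ι P k ≫ sigmaProj P k = 𝟙 _ := by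
  simp [sigmaProj]

lemma ι_sigmaProj_of_ne {j k : ℕ} (h : j ≠ k) : Sigma.ι P j ≫ sigmaProj P k = 0 := by
  simp [sigmaProj, h]

variable (T : ℤ ⥤ 𝒯)

lemma ι_oneSubShift (m : ℕ) :
    Sigma.ι (fun n : ℕ ↦ T.obj n) m ≫ oneSubShift T = Sigma.ι (fun n : ℕ ↦ T.obj n) m -
      T.map (homOfLE (show (m : ℤ) ≤ ((m + 1 : ℕ) : ℤ) by omega)) ≫
        Sigma.ι (fun n : ℕ ↦ T.obj n) (m + 1) :=
  Sigma.ι_desc _ _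

lemma oneSubShift_sigmaProj_zero :
    oneSubShift T ≫ sigmaProj (fun n : ℕ ↦ T.obj n) 0 = sigmaProj (fun n : ℕ ↦ T.obj n) 0 := by
  refine Sigma.hom_ext _ _ fun m ↦ ?_
  rw [← assoc, ι_oneSubShift, Preadditive.sub_comp, assoc, ι_sigmaProj_of_ne (Nat.succ_ne_zero m),
    comp_zero, sub_zero]

/-- In coordinates, `1 - shift` fixes component `0` and turns `y_{k+1}` into `y_{k+1}` minus the
image of `y_k`. Equations involving it can thus be solved recursively. -/
lemma oneSubShift_sigmaProj_succ (k : ℕ) :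
    oneSubShift T ≫ sigmaProj (fun n : ℕ ↦ T.obj n) (k + 1) =
      sigmaProj (fun n : ℕ ↦ T.obj n) (k + 1) - sigmaProj (fun n : ℕ ↦ T.obj n) k ≫
        T.map (homOfLE (show (k : ℤ) ≤ ((k + 1 : ℕ) : ℤ) by omega)) := by
  refine Sigma.hom_ext _ _ fun m ↦ ?_
  rw [← assoc, ι_oneSubShift, Preadditive.sub_comp, Preadditive.comp_sub, assoc]
  congr 1
  by_cases h : m = k
  · subst h
    rw [ι_sigmaProj_self, comp_id, ← assoc, ι_sigmaProj_self, id_comp]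
  · rw [ι_sigmaProj_of_ne (by omega), comp_zero, ← assoc, ι_sigmaProj_of_ne h, zero_comp]

variable {T} [HasShift 𝒯 ℤ] [∀ n : ℤ, (shiftFunctor 𝒯 n).Additive]

/-- Every map from a compact object to a shifted coproduct is the sum of its components, all but
finitely many of which vanish. -/
lemma IsCompactForCoproducts.exists_eq_sum
    (hS : IsCompactForCoproducts S) (y : S ⟶ (∐ P)⟦n⟧) :
    ∃ M : ℕ, (∀ k, M ≤ k → y ≫ (sigmaProj P k)⟦n⟧' = 0) ∧
      y = ∑ k ∈ Finset.range M, (y ≫ (sigmaProj P k)⟦n⟧') ≫ (Sigma.ι P k)⟦n⟧' := by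
  -- Compactness is applied to the coproduct of the shifted objects, so no compactness of shifts of
  -- `S` is needed.
  obtain ⟨F, g, hg⟩ := hS (fun m ↦ (P m)⟦n⟧) (y ≫ inv (sigmaComparison (shiftFunctor 𝒯 n) P))
  have hy : y = ∑ k ∈ F, g k ≫ (Sigma.ι P k)⟦n⟧' := by
    rw [← cancel_mono (inv (sigmaComparison (shiftFunctor 𝒯 n) P)), hg, Preadditive.sum_comp]
    refine Finset.sum_congr rfl fun k _ ↦ ?_
    rw [assoc, ← ι_comp_sigmaComparison, assoc, IsIso.hom_inv_id, comp_id]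
  have hk (k : ℕ) : y ≫ (sigmaProj P k)⟦n⟧' = if k ∈ F then g k else 0 := by
    have hj (j : ℕ) (h : j ≠ k) :
        (g j ≫ (Sigma.ι P j)⟦n⟧') ≫ (sigmaProj P k)⟦n⟧' = 0 := by
      rw [assoc, ← Functor.map_comp, ι_sigmaProj_of_ne h, Functor.map_zero, comp_zero]
    rw [hy, Preadditive.sum_comp]
    split_ifs with h
    · rw [Finset.sum_eq_single_of_mem k h fun j _ ↦ hj j, assoc, ← Functor.map_comp,
        ι_sigmaProj_self, CategoryTheory.Functor.map_id, comp_id]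
    · exact Finset.sum_eq_zero fun j hjF ↦ hj j fun e ↦ h (e ▸ hjF)
  obtain ⟨M, hM⟩ : ∃ M, ∀ k ∈ F, k < M := ⟨F.sup id + 1, fun k hk ↦
    Nat.lt_succ_of_le (Finset.le_sup (f := id) hk)⟩
  refine ⟨M, fun k hkM ↦ ?_, ?_⟩
  · rw [hk, if_neg fun h ↦ by have := hM k h; omega]
  · conv_lhs => rw [hy]
    rw [← Finset.sum_subset (fun k h ↦ Finset.mem_range.2 (hM k h))]
    · exact Finset.sum_congr rfl fun k h ↦ by rw [hk, if_pos h]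
    · intro k _ h
      rw [hk, if_neg h, zero_comp]

/-- For compact `S` the map `1 - shift` is injective on `[S, Σ^n ∐ T_m]`. -/
lemma IsCompactForCoproducts.eq_zero_of_comp_oneSubShift (hS : IsCompactForCoproducts S)
    (y : S ⟶ (∐ fun n : ℕ ↦ T.obj n)⟦n⟧) (hy : y ≫ (oneSubShift T)⟦n⟧' = 0) : y = 0 := by
  have hk (k : ℕ) : y ≫ (sigmaProj (fun n : ℕ ↦ T.obj n) k)⟦n⟧' = 0 := by
    induction k with
    | zero =>
      rw [← oneSubShift_sigmaProj_zero, Functor.map_comp, reassoc_of% hy, zero_comp]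
    | succ k ih =>
      have h := congrArg (fun z ↦ y ≫ z⟦n⟧') (oneSubShift_sigmaProj_succ T k)
      simp only [Functor.map_comp, Functor.map_sub, Preadditive.comp_sub] at h
      rw [reassoc_of% hy, zero_comp, reassoc_of% ih, zero_comp, sub_zero] at h
      exact h.symm
  obtain ⟨M, -, h⟩ := hS.exists_eq_sum y
  rw [h]
  exact Finset.sum_eq_zero fun k _ ↦ by rw [hk, zero_comp]

/-- For compact `S`, a class in `[S, Σ^n T_m]` whose image in `[S, Σ^n ∐ T_m]` is in the image
of `1 - shift` dies at a finite stage. -/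
lemma IsCompactForCoproducts.exists_comp_map_eq_zero (hS : IsCompactForCoproducts S) (m : ℕ)
    (a : S ⟶ (T.obj m)⟦n⟧) (y : S ⟶ (∐ fun n : ℕ ↦ T.obj n)⟦n⟧)
    (hy : y ≫ (oneSubShift T)⟦n⟧' = a ≫ (Sigma.ι (fun n : ℕ ↦ T.obj n) m)⟦n⟧') :
    ∃ (k : ℕ) (h : (m : ℤ) ≤ k), a ≫ (T.map (homOfLE h))⟦n⟧' = 0 := by
  -- The recursion forces the components of `y` to be zero below `m` and the successive images of
  -- `a` from `m` on.
  have hk (k : ℕ) : y ≫ (sigmaProj (fun n : ℕ ↦ T.obj n) k)⟦n⟧' =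
      if h : (m : ℤ) ≤ k then a ≫ (T.map (homOfLE h))⟦n⟧' else 0 := by
    induction k with
    | zero =>
      rw [← oneSubShift_sigmaProj_zero, Functor.map_comp, reassoc_of% hy, ← Functor.map_comp]
      split_ifs with h
      · obtain rfl : m = 0 := by omega
        rw [ι_sigmaProj_self]
        simp
      · rw [ι_sigmaProj_of_ne (by omega), Functor.map_zero, comp_zero]
    | succ k ih =>
      have h := congrArg (fun z ↦ y ≫ z⟦n⟧') (oneSubShift_sigmaProj_succ T k)
      simp only [Functor.map_comp, Functor.map_sub, Preadditive.comp_sub] at h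
      rw [reassoc_of% hy, ← assoc y, ih, eq_sub_iff_add_eq, ← Functor.map_comp] at h
      rw [← h]
      by_cases h₁ : m ≤ k
      · rw [ι_sigmaProj_of_ne (by omega), Functor.map_zero, comp_zero, zero_add,
          dif_pos (by exact_mod_cast h₁), dif_pos (by omega), assoc, ← Functor.map_comp,
          ← Functor.map_comp]
        rfl
      · rw [dif_neg (by exact_mod_cast h₁), zero_comp, add_zero]
        split_ifs with h₂
        · obtain rfl : m = k + 1 := by omega
          rw [ι_sigmaProj_self]
          simp
        · rw [ι_sigmaProj_of_ne (by omega), Functor.map_zero, comp_zero]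
  obtain ⟨M, hM, -⟩ := hS.exists_eq_sum y
  -- This index is at least `M`, so the component of `y` is zero, and at least `m`, so that
  -- component is the image of `a`.
  refine ⟨m + M, by omega, ?_⟩
  have := hk (m + M)
  rwa [hM _ (by omega), dif_pos (by omega), eq_comm] at this

end Coproducts

/-! ### The homotopy colimit and conditional convergence -/

variable [Preadditive 𝒯] [HasZeroObject 𝒯] [HasShift 𝒯 ℤ]
  [∀ n : ℤ, (shiftFunctor 𝒯 n).Additive] [Pretriangulated 𝒯]

namespace Totalization

variable {C : SimplicialObject 𝒯} (X : Totalization C)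

/-- The inclusion of `T_s` into the coproduct of the skeleta. -/
noncomputable def toSigma : ∀ s : ℤ, X.skel.obj s ⟶ ∐ fun n : ℕ ↦ X.skel.obj n :=
  fun s ↦ match s with
  | Int.ofNat n => Sigma.ι (fun n : ℕ ↦ X.skel.obj n) n
  | Int.negSucc _ => 0

lemma toTot_eq (s : ℤ) : X.toTot s = X.toSigma s ≫ X.incl := by
  match s with
  | Int.ofNat n => rfl
  | Int.negSucc _ => exact zero_comp.symm

lemma map_toSigma_of_eq {s s' : ℤ} (h : s = s') :
    X.skel.map (homOfLE h.le) ≫ X.toSigma s' = X.toSigma s := by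
  subst h
  simp

lemma toSigma_oneSubShift (s s' : ℤ) (h : s + 1 = s') :
    X.toSigma s ≫ oneSubShift X.skel =
      X.toSigma s - X.skel.map (homOfLE (show s ≤ s' by omega)) ≫ X.toSigma s' := by
  subst h
  by_cases hs : 0 ≤ s
  · lift s to ℕ using hs
    exact ι_oneSubShift X.skel s
  · exact (X.isZero_skel s (by omega)).eq_of_src _ _

lemma oneSubShift_incl : oneSubShift X.skel ≫ X.incl = 0 :=
  comp_distTriang_mor_zero₁₂ _ X.distinguished_tot

/-- One step up the tower is the vanishing of `oneSubShift` followed by `incl`; negative indices are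
harmless as the skeleta there are zero. -/
lemma map_toTot {s s' : ℤ} (h : s ≤ s') : X.skel.map (homOfLE h) ≫ X.toTot s' = X.toTot s := by
  have key (d : ℕ) : ∀ (t : ℤ) (ht : s + d = t),
      X.skel.map (homOfLE (show s ≤ t by omega)) ≫ X.toTot t = X.toTot s := by
    induction d with
    | zero =>
      intro t ht
      obtain rfl : s = t := by simpa using ht
      simp
    | succ d ih =>
      intro t ht
      have h₁ : X.toTot (t - 1) = X.skel.map (homOfLE (show t - 1 ≤ t by omega)) ≫ X.toTot t := by
        rw [toTot_eq, toTot_eq, ← assoc, ← sub_eq_zero, ← Preadditive.sub_comp,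
          ← X.toSigma_oneSubShift (t - 1) t (by omega), assoc, oneSubShift_incl, comp_zero]
      rw [← ih (t - 1) (by push_cast at ht; omega), h₁, ← Functor.map_comp_assoc]
      rfl
  exact key (s' - s).toNat s' (by omega)

lemma skelShift_toTot {s s' : ℤ} (h : s ≤ s') (n : ℤ) :
    X.skelShift h n ≫ (X.toTot s')⟦n⟧' = (X.toTot s)⟦n⟧' := by
  rw [skelShift, ← Functor.map_comp, map_toTot]

lemma skelShift_comp {s s' s'' : ℤ} (h : s ≤ s') (h' : s' ≤ s'') (n : ℤ) :
    X.skelShift h n ≫ X.skelShift h' n = X.skelShift (h.trans h') n := by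
  rw [skelShift, skelShift, skelShift, ← Functor.map_comp, ← Functor.map_comp]
  rfl

variable (S)

/-- Maps out of the coproduct of the skeleta, as families of maps out of the skeleta. -/
noncomputable def sigmaRestrict (n : ℤ) :
    ((∐ fun n : ℕ ↦ X.skel.obj n)⟦n⟧ ⟶ S) →+ ∀ m : ℕ, (X.cohCouple S).A m n :=
  AddMonoidHom.pi fun m : ℕ ↦ Preadditive.leftComp S ((X.toSigma ((m : ℤ) - 1))⟦n⟧')

lemma sigmaRestrict_apply (n : ℤ) (w : (∐ fun n : ℕ ↦ X.skel.obj n)⟦n⟧ ⟶ S) (m : ℕ) :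
    X.sigmaRestrict S n w m = (X.toSigma ((m : ℤ) - 1))⟦n⟧' ≫ w := rfl

/-- In the couple `A m n` belongs to `T_{m-1}`. The factor `m = 0` is zero because `T_{-1} = 0`, so
this is the universal property of the coproduct with indices moved by one. -/
lemma sigmaRestrict_bijective (n : ℤ) : Function.Bijective (X.sigmaRestrict S n) := by
  constructor
  · rw [injective_iff_map_eq_zero]
    intro w hw
    refine sigma_shift_hom_ext fun m ↦ ?_
    have h₁ : (X.toSigma (((m + 1 : ℕ) : ℤ) - 1))⟦n⟧' ≫ w = 0 := congrFun hw (m + 1)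
    have h₂ := X.map_toSigma_of_eq (show (m : ℤ) = ((m + 1 : ℕ) : ℤ) - 1 by push_cast; omega)
    change X.skel.map _ ≫ _ = Sigma.ι (fun n : ℕ ↦ X.skel.obj n) m at h₂
    rw [← h₂, Functor.map_comp, assoc, h₁, comp_zero, comp_zero]
  · intro a
    obtain ⟨w, hw⟩ := exists_sigma_shift_desc (P := fun n : ℕ ↦ X.skel.obj n) (n := n) (S := S)
      (fun m ↦ X.skelShift (show (m : ℤ) ≤ ((m + 1 : ℕ) : ℤ) - 1 by push_cast; omega) n ≫ a (m + 1))
    refine ⟨w, funext fun m ↦ ?_⟩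
    obtain _ | m := m
    · exact (X.isZero_skelShift _ _ (by simp)).eq_of_src _ _
    · rw [sigmaRestrict_apply, ← X.map_toSigma_of_eq
        (show ((m + 1 : ℕ) : ℤ) - 1 = (m : ℤ) by push_cast; omega), Functor.map_comp, assoc]
      change X.skelShift _ n ≫ (Sigma.ι (fun n : ℕ ↦ X.skel.obj n) m)⟦n⟧' ≫ w = _
      rw [hw]
      refine (assoc _ _ _).symm.trans ?_
      rw [skelShift_comp, skelShift_self]
      exact id_comp _

/-- Maps out of the coproduct of the skeleta are families of maps out of the skeleta. -/
noncomputable def sigmaEquiv (n : ℤ) :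
    ((∐ fun n : ℕ ↦ X.skel.obj n)⟦n⟧ ⟶ S) ≃+ ∀ m : ℕ, (X.cohCouple S).A m n :=
  AddEquiv.ofBijective _ (X.sigmaRestrict_bijective S n)

lemma sigmaRestrict_oneSubShift (n : ℤ) (w : (∐ fun n : ℕ ↦ X.skel.obj n)⟦n⟧ ⟶ S) :
    X.sigmaRestrict S n ((oneSubShift X.skel)⟦n⟧' ≫ w) =
      (X.cohCouple S).limDiff n (X.sigmaRestrict S n w) := by
  funext m
  change _ = (X.toSigma _)⟦n⟧' ≫ w - X.skelShift _ n ≫ (X.toSigma _)⟦n⟧' ≫ w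
  rw [sigmaRestrict_apply, ← Functor.map_comp_assoc,
    X.toSigma_oneSubShift ((m : ℤ) - 1) (((m + 1 : ℕ) : ℤ) - 1) (by push_cast; omega),
    Functor.map_sub, Preadditive.sub_comp, Functor.map_comp, assoc]
  rfl

lemma sigmaRestrict_incl (n : ℤ) (x : X.tot⟦n⟧ ⟶ S) (m : ℕ) :
    X.sigmaRestrict S n (X.incl⟦n⟧' ≫ x) m = (X.toTot ((m : ℤ) - 1))⟦n⟧' ≫ x := by
  rw [sigmaRestrict_apply, toTot_eq, Functor.map_comp, assoc]

/-- The connecting map `Σ^n Tot ⟶ Σ^{n+1} ∐ T_m`. -/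
noncomputable def connShift (n : ℤ) :
    X.tot⟦n⟧ ⟶ (∐ fun n : ℕ ↦ X.skel.obj n)⟦n + 1⟧ :=
  X.conn⟦n⟧' ≫ (shiftFunctorAdd' 𝒯 1 n (n + 1) (by omega)).inv.app _

lemma connShift_comp_eq_zero_iff (n : ℤ) (w : (∐ fun n : ℕ ↦ X.skel.obj n)⟦n + 1⟧ ⟶ S) :
    X.connShift n ≫ w = 0 ↔ ∃ v, (oneSubShift X.skel)⟦n + 1⟧' ≫ v = w := by
  have hnat := (shiftFunctorAdd' 𝒯 1 n (n + 1) (by omega)).inv.naturality (oneSubShift X.skel)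
  constructor
  · intro h
    rw [connShift, assoc] at h
    obtain ⟨v, hv⟩ := yoneda_exact_shift₁ X.distinguished_tot n h
    refine ⟨(shiftFunctorAdd' 𝒯 1 n (n + 1) (by omega)).hom.app _ ≫ v, ?_⟩
    rw [← cancel_epi ((shiftFunctorAdd' 𝒯 1 n (n + 1) (by omega)).inv.app _),
      ← reassoc_of% hnat, Iso.inv_hom_id_app_assoc]
    exact hv
  · rintro ⟨v, rfl⟩
    have h₀ : X.conn ≫ (oneSubShift X.skel)⟦(1 : ℤ)⟧' = 0 :=
      comp_distTriang_mor_zero₃₁ _ X.distinguished_tot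
    rw [connShift, assoc, ← reassoc_of% hnat]
    change X.conn⟦n⟧' ≫ ((oneSubShift X.skel)⟦(1 : ℤ)⟧')⟦n⟧' ≫ _ = 0
    rw [← Functor.map_comp_assoc, h₀, Functor.map_zero, zero_comp]

lemma incl_comp_eq_zero_iff (n : ℤ) (x : X.tot⟦n⟧ ⟶ S) :
    X.incl⟦n⟧' ≫ x = 0 ↔ ∃ w, X.connShift n ≫ w = x := by
  constructor
  · intro h
    obtain ⟨w, hw⟩ := yoneda_exact_shift₃ X.distinguished_tot n h
    refine ⟨(shiftFunctorAdd' 𝒯 1 n (n + 1) (by omega)).hom.app _ ≫ w, ?_⟩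
    rw [connShift, assoc, Iso.inv_hom_id_app_assoc, hw]
  · rintro ⟨w, rfl⟩
    have h₀ : X.incl ≫ X.conn = 0 := comp_distTriang_mor_zero₂₃ _ X.distinguished_tot
    rw [connShift, assoc, ← Functor.map_comp_assoc, h₀, Functor.map_zero, zero_comp]

/-- The map `∏ A_m ⟶ [Σ^n Tot, S]` that induces the map from the derived limit. -/
noncomputable def prodToTot (n : ℤ) :
    (∀ m : ℕ, (X.cohCouple S).A m (n + 1)) →+ (X.tot⟦n⟧ ⟶ S) :=
  (Preadditive.leftComp S (X.connShift n)).comp (X.sigmaEquiv S (n + 1)).symm.toAddMonoidHom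

lemma prodToTot_sigmaRestrict (n : ℤ) (w : (∐ fun n : ℕ ↦ X.skel.obj n)⟦n + 1⟧ ⟶ S) :
    X.prodToTot S n (X.sigmaRestrict S (n + 1) w) = X.connShift n ≫ w := by
  have : (X.sigmaEquiv S (n + 1)).symm (X.sigmaRestrict S (n + 1) w) = w :=
    (X.sigmaEquiv S (n + 1)).symm_apply_apply w
  exact congrArg (X.connShift n ≫ ·) this

/-- By exactness at `Σ^{n+1} ∐ T_m`, the kernel is the image of `1 - shift`, which is `limDiff` in
coordinates. So the map descends to an injection of the derived limit. -/
lemma prodToTot_eq_zero_iff (n : ℤ) (a : ∀ m : ℕ, (X.cohCouple S).A m (n + 1)) :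
    X.prodToTot S n a = 0 ↔ a ∈ ((X.cohCouple S).limDiff (n + 1)).range := by
  obtain ⟨w, rfl⟩ := (X.sigmaRestrict_bijective S (n + 1)).2 a
  rw [prodToTot_sigmaRestrict, connShift_comp_eq_zero_iff, AddMonoidHom.mem_range,
    (X.sigmaRestrict_bijective S (n + 1)).2.exists]
  simp only [← sigmaRestrict_oneSubShift, (X.sigmaRestrict_bijective S (n + 1)).1.eq_iff]

lemma convergesConditionallyToLimit :
    (X.cohCouple S).ConvergesConditionallyToLimit (fun n ↦ (X.tot⟦n⟧ ⟶ S))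
      (fun σ n ↦ Preadditive.leftComp S ((X.toTot (σ - 1))⟦n⟧')) where
  colim_eq_zero σ n a :=
    -- At filtration at most `0` the skeleton involved has index at most `-1`.
    ⟨min σ 0, min_le_left _ _, (X.isZero_skelShift _ _ (by omega)).eq_of_src _ _⟩
  compat h n x := by
    change X.skelShift _ n ≫ (X.toTot _)⟦n⟧' ≫ x = (X.toTot _)⟦n⟧' ≫ x
    rw [← assoc, skelShift_toTot]
  lim_surjective n a ha := by
    obtain ⟨w, rfl⟩ := (X.sigmaRestrict_bijective S n).2 a
    rw [← sigmaRestrict_oneSubShift] at ha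
    obtain ⟨x, rfl⟩ := yoneda_exact_shift X.distinguished_tot n
      ((injective_iff_map_eq_zero _).1 (X.sigmaRestrict_bijective S n).1 _ ha)
    exact ⟨x, fun m ↦ (X.sigmaRestrict_incl S n x m).symm⟩
  ker_eq_limOne n := by
    refine ⟨QuotientAddGroup.lift _ (X.prodToTot S n)
      (fun a ha ↦ (X.prodToTot_eq_zero_iff S n a).2 ha), ?_, fun x ↦ ?_⟩
    · rw [injective_iff_map_eq_zero]
      intro a ha
      obtain ⟨a, rfl⟩ := QuotientAddGroup.mk'_surjective _ a
      exact (QuotientAddGroup.eq_zero_iff _).2 ((X.prodToTot_eq_zero_iff S n a).1 ha)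
    · have h₁ : (∀ m : ℕ, (X.toTot ((m : ℤ) - 1))⟦n⟧' ≫ x = 0) ↔ X.incl⟦n⟧' ≫ x = 0 := by
        rw [← map_eq_zero_iff _ (X.sigmaRestrict_bijective S n).1, funext_iff]
        exact forall_congr' fun m ↦ by rw [sigmaRestrict_incl]; rfl
      refine Iff.trans ?_ h₁.symm
      rw [incl_comp_eq_zero_iff]
      constructor
      · rintro ⟨a, rfl⟩
        obtain ⟨a, rfl⟩ := QuotientAddGroup.mk'_surjective _ a
        obtain ⟨w, rfl⟩ := (X.sigmaRestrict_bijective S (n + 1)).2 a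
        exact ⟨w, (X.prodToTot_sigmaRestrict S n w).symm⟩
      · rintro ⟨w, rfl⟩
        exact ⟨QuotientAddGroup.mk' _ (X.sigmaRestrict S (n + 1) w),
          X.prodToTot_sigmaRestrict S n w⟩

/-- The term `a (m + 1)` maps into `T_{-(m+1)} = 0`, so the shift contributes nothing. -/
lemma limDiff_homCouple (n : ℤ) (a : ∀ m : ℕ, (X.homCouple S).A m n) :
    (X.homCouple S).limDiff n a = a := by
  funext m
  have : a (m + 1) = 0 := (X.isZero_skelShift _ _ (by push_cast; omega)).eq_of_tgt _ _
  change a m - (X.homCouple S).i _ n (a (m + 1)) = a m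
  rw [this, map_zero, sub_zero]

lemma convergesConditionallyToColimit : (X.homCouple S).ConvergesConditionallyToColimit where
  lim_eq_zero n a b h := by rwa [limDiff_homCouple, limDiff_homCouple] at h
  limOne_eq_zero n a := ⟨a, X.limDiff_homCouple S n a⟩

-- Every stage beyond some `M` is allowed because the couple presents skeleta with indices such as
-- `-(-M)`.
variable {S} in
lemma exists_comp_toTot_eq (hS : IsCompactForCoproducts S) (n : ℤ) (x : S ⟶ X.tot⟦n⟧) :
    ∃ (M : ℕ), ∀ s : ℤ, (M : ℤ) ≤ s → ∃ a : S ⟶ (X.skel.obj s)⟦n⟧, a ≫ (X.toTot s)⟦n⟧' = x := by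
  -- The connecting map followed by the suspended `1 - shift` is zero, and `1 - shift` is injective
  -- on maps from a compact object.
  have h₀ : x ≫ X.connShift n = 0 := by
    refine hS.eq_zero_of_comp_oneSubShift _ ?_
    have hnat := (shiftFunctorAdd' 𝒯 1 n (n + 1) (by omega)).inv.naturality (oneSubShift X.skel)
    have h₀ : X.conn ≫ (oneSubShift X.skel)⟦(1 : ℤ)⟧' = 0 :=
      comp_distTriang_mor_zero₃₁ _ X.distinguished_tot
    rw [connShift, assoc, assoc, ← hnat]
    change _ ≫ X.conn⟦n⟧' ≫ ((oneSubShift X.skel)⟦(1 : ℤ)⟧')⟦n⟧' ≫ _ = 0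
    rw [← Functor.map_comp_assoc, h₀, Functor.map_zero, zero_comp, comp_zero]
  rw [connShift, ← assoc, Preadditive.IsIso.comp_right_eq_zero] at h₀
  obtain ⟨z, rfl⟩ := coyoneda_exact_shift₃ X.distinguished_tot n h₀
  obtain ⟨M, -, hM⟩ := hS.exists_eq_sum z
  -- The finitely many components of the lift `z` are pushed forward to the common stage `s` and
  -- added there.
  refine ⟨M, fun s hs ↦ ⟨∑ k ∈ (Finset.range M).attach,
    (z ≫ (sigmaProj (fun n : ℕ ↦ X.skel.obj n) k)⟦n⟧') ≫
      X.skelShift (show ((k : ℕ) : ℤ) ≤ s by have := Finset.mem_range.1 k.2; omega) n, ?_⟩⟩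
  rw [Preadditive.sum_comp]
  conv_rhs => rw [hM, Preadditive.sum_comp, ← Finset.sum_attach]
  refine Finset.sum_congr rfl fun k _ ↦ ?_
  rw [assoc, skelShift_toTot, toTot_eq, Functor.map_comp]
  simp only [assoc]
  rfl

variable {S} in
lemma exists_comp_skelShift_eq_zero (hS : IsCompactForCoproducts S) (s n : ℤ)
    (a : S ⟶ (X.skel.obj s)⟦n⟧) (ha : a ≫ (X.toTot s)⟦n⟧' = 0) :
    ∃ (s' : ℤ) (h : s ≤ s'), a ≫ X.skelShift h n = 0 := by
  by_cases hs : 0 ≤ s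
  · lift s to ℕ using hs
    rw [toTot_eq, Functor.map_comp, ← assoc] at ha
    obtain ⟨y, hy⟩ := coyoneda_exact_shift X.distinguished_tot n ha
    obtain ⟨k, h, hk⟩ := hS.exists_comp_map_eq_zero s a y hy
    exact ⟨k, h, hk⟩
  · exact ⟨s, le_rfl, by
      rw [(X.isZero_skelShift _ _ (by omega)).eq_of_tgt a 0, zero_comp]⟩

lemma isColimit_homCouple (hS : IsCompactForCoproducts S) :
    (X.homCouple S).IsColimit (fun n ↦ (S ⟶ X.tot⟦n⟧))
      (fun σ n ↦ Preadditive.rightComp S ((X.toTot (-σ))⟦n⟧')) where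
  compat h n a := by
    refine (assoc _ _ _).trans ?_
    rw [skelShift_toTot]
    rfl
  surjective n x := by
    obtain ⟨M, hM⟩ := X.exists_comp_toTot_eq hS n x
    obtain ⟨a, ha⟩ := hM (-(-(M : ℤ))) (by omega)
    exact ⟨-(M : ℤ), a, ha⟩
  injective σ n a ha := by
    obtain ⟨s', h, hs'⟩ := X.exists_comp_skelShift_eq_zero hS (-σ) n a ha
    refine ⟨-s', by omega, ?_⟩
    refine (congrArg (a ≫ ·)
      (X.skelShift_comp h (show s' ≤ -(-s') by omega) n)).symm.trans ?_
    exact (assoc _ _ _).symm.trans ((congrArg (· ≫ _) hs').trans zero_comp)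

/-! ### Identification of `d_1` with the alternating sum of the face maps -/

lemma skelShift_projShift (s s₁ s' n t : ℤ) (h : s = s') (h₁ : s₁ = s') (hle : s ≤ s₁)
    (ht : s' + n = t) :
    X.skelShift hle n ≫ X.projShift s₁ s' n t h₁ ht = X.projShift s s' n t h ht := by
  subst h h₁
  rw [skelShift_self, id_comp]

lemma attachShift_skelShift (s s₁ s' n t : ℤ) (h : s + 1 = s') (h₁ : s₁ + 1 = s') (hle : s ≤ s₁)
    (ht : s + n = t) :
    X.attachShift s s' n t h ht ≫ X.skelShift hle n =
      X.attachShift s₁ s' n t h₁ (by omega) := by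
  obtain rfl : s = s₁ := by omega
  rw [skelShift_self, comp_id]

lemma attachShift_projShift_of_eq (s i s' n t : ℤ) (h : s + 1 = s') (hi : s = i) (ht : s + n = t)
    (ht' : i + n = t) :
    X.attachShift s s' n t h ht ≫ X.projShift s i n t hi ht' = ((altComplex C).d s' i)⟦t⟧' := by
  subst hi
  exact attachShift_projShift s s' n t h ht

/-- For `r = 1` the lift passes through no step, so it is `k x` itself up to rewriting indices, and
`j` of it is given by the attaching map followed by the projection, which is the suspended `d`. -/
lemma cohCouple_diffRel_one (s s' t : ℤ)
    (h : ((s, t) : ℤ × ℤ) + cohGrading.shift 1 = (s', t))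
    (x : ((altComplex C).X s)⟦t⟧ ⟶ S) :
    (X.cohCouple S).DiffRel (p := (s, t)) (q := (s', t)) 1 le_rfl h x
      (((altComplex C).d s' s)⟦t⟧' ≫ x) := by
  have h₁ : s + 1 = s' := congrArg Prod.fst h
  refine ⟨X.projShift (s' - 1) s (t - s' + 1) t (by omega) (by omega) ≫ x, ?_, ?_⟩
  · exact (assoc _ _ _).symm.trans (congrArg (· ≫ x) (X.skelShift_projShift _ _ _ _ _ _ _ _ _))
  · exact (assoc _ _ _).symm.trans
      (congrArg (· ≫ x) (X.attachShift_projShift_of_eq _ _ _ _ _ _ _ _ _))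

lemma homCouple_diffRel_one (s s' t : ℤ)
    (h : ((s', t) : ℤ × ℤ) + homGrading.shift 1 = (s, t))
    (x : S ⟶ ((altComplex C).X s')⟦t⟧) :
    (X.homCouple S).DiffRel (p := (s', t)) (q := (s, t)) 1 le_rfl h x
      (x ≫ ((altComplex C).d s' s)⟦t⟧') := by
  have h₁ : s' + (-1) = s := congrArg Prod.fst h
  refine ⟨x ≫ X.attachShift (-(-s)) s' (t - s) t (by omega) (by omega), ?_, ?_⟩
  · exact (assoc _ _ _).trans (congrArg (x ≫ ·) (X.attachShift_skelShift _ _ _ _ _ _ _ _ _))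
  · exact (assoc _ _ _).trans
      (congrArg (x ≫ ·) (X.attachShift_projShift_of_eq _ _ _ _ _ _ _ _ _))

lemma isCohSkeletalSS : X.IsCohSkeletalSS S where
  isZero s t hs := (X.cohCouple S).isZero_page_one (s, t)
    ⟨fun _ _ ↦ ((shiftFunctor 𝒯 t).map_isZero (isZero_altComplex_X C s hs)).eq_of_src _ _⟩
  d_one n t x := by
    have H := X.cohCouple_diffRel_one S n (n + 1 : ℕ) t (by simp [cohGrading]) x
    rw [altComplex_d_succ] at H
    exact ExactCouple.page_one_d_pageOneIso _ _ _ H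
  converges := X.convergesConditionallyToLimit S

lemma isHomSkeletalSS : X.IsHomSkeletalSS S where
  isZero s t hs := (X.homCouple S).isZero_page_one (s, t)
    ⟨fun _ _ ↦ ((shiftFunctor 𝒯 t).map_isZero (isZero_altComplex_X C s hs)).eq_of_tgt _ _⟩
  d_one n t x := by
    have H := X.homCouple_diffRel_one S n (n + 1 : ℕ) t (by simp [homGrading]) x
    rw [altComplex_d_succ] at H
    exact ExactCouple.page_one_d_pageOneIso _ _ _ H
  converges := X.convergesConditionallyToColimit S
  abutment := X.isColimit_homCouple S

end Totalization

end

theorem mainTheorem3 {𝒯 : Type u} [Category.{v} 𝒯] [Preadditive 𝒯] [HasZeroObject 𝒯]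
    [HasShift 𝒯 ℤ] [∀ n : ℤ, (shiftFunctor 𝒯 n).Additive] [Pretriangulated 𝒯]
    [IsTriangulated 𝒯] [HasCoproductsOfShape ℕ 𝒯] {C D : SimplicialObject 𝒯}
    (X : Totalization C) (Y : Totalization D) (f : C ⟶ D) (S : 𝒯) :
    (X.IsCohSkeletalSS S ∧ Y.IsCohSkeletalSS S ∧
      Nonempty (X.CohPageMaps Y f S 2) ∧
      ∀ k : ℕ, 2 < k →
        (∀ (N : ℕ) (hN : 2 ≤ N) (i : ℕ), N < k → 0 ∈ X.todaBracket Y f N hN i) →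
        Nonempty (X.CohPageMaps Y f S k)) ∧
    (X.IsHomSkeletalSS S ∧ Y.IsHomSkeletalSS S ∧
      Nonempty (X.HomPageMaps Y f S 2) ∧
      ∀ k : ℕ, 2 < k →
        (∀ (N : ℕ) (hN : 2 ≤ N) (i : ℕ), N < k → 0 ∈ X.todaBracket Y f N hN i) →
        Nonempty (X.HomPageMaps Y f S k)) := by
  -- For `k = 2` no bracket is in range, so the unconditional statement about `E_1` is this case of
  -- the general construction.
  have hN (N : ℕ) (hN : 2 ≤ N) (i : ℕ) (h : N < 2) : 0 ∈ X.todaBracket Y f N hN i := by omega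
  exact ⟨⟨X.isCohSkeletalSS S, Y.isCohSkeletalSS S, ⟨Totalization.cohPageMaps S 2 hN⟩,
      fun k _ H ↦ ⟨Totalization.cohPageMaps S k H⟩⟩,
    ⟨X.isHomSkeletalSS S, Y.isHomSkeletalSS S, ⟨Totalization.homPageMaps S 2 hN⟩,
      fun k _ H ↦ ⟨Totalization.homPageMaps S k H⟩⟩⟩
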